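/- **Setting.** There are $M\ge 1$ clients. Client $i$ has either a local dataset of finite size $n$ (the same $n$ for all clients; a batch of $s\le n$ samples is drawn uniformly without replacement) or, in the streaming case $n=\infty$, a sample distribution (a batch consists of $s$ i.i.d. samples). For a batch $B$, $f_i(x,B)$ is the average over $B$ of differentiable sample losses, $F_i(x)=\mathbb E f_i(x,B)$, and $F=\frac1M\sum_i F_i:\mathbb R^d\to\mathbb R$ is bounded below with infimum $F_*$. Assume that for constants $L>0$, $\sigma>0$, $L_\sigma\ge 0$, all $i$, all $v,w\in\mathbb R^d$ and all batch sizes $|B|$: (i) $\|\nabla F_i(v)-\nabla F_i(w)\|\le L\|v-w\|$; (ii) $\mathbb E\|\nabla f_i(v,B)-\nabla F_i(v)\|^2\le \sigma^2/|B|$; (iii) $\mathbb E\|(\nabla f_i(v,B)-\nabla f_i(w,B))-(\nabla F_i(v)-\nabla F_i(w))\|^2\le \frac{L_\sigma^2}{|B|}\|v-w\|^2$. **Algorithm (FedAMD, full participation, sequential probabilities).** Let $\tau\ge2$, $K\ge1$, $1\le b,b'\le n$, $p_t=1$ if $\tau\mid t$ and $p_t=0$ otherwise. Given $x_0$ and caching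 gradients $v_0^{(i)}$, in round $t=0,1,2,\dots$ every client $i\in[M]$ is an anchor with probability $p_t$ and a miner otherwise; let $g_t=\frac1M\sum_i v_t^{(i)}$. An anchor draws a batch $B$ of size $b$ and sets $v_{t+1}^{(i)}=\nabla f_i(x_t,B)$; a miner keeps $v^{(i)}_{t+1}=v^{(i)}_t$, starts from $x_{t,-1}^{(i)}=x_{t,0}^{(i)}=x_t$, $g_{t,0}^{(i)}=g_t$, and for $k=0,\dots,K-1$ draws a batch $B_k$ of size $b'$ and sets $g_{t,k+1}^{(i)}=g_{t,k}^{(i)}-\nabla f_i(x_{t,k-1}^{(i)},B_k)+\nabla f_i(x_{t,k}^{(i)},B_k)$, $x_{t,k+1}^{(i)}=x_{t,k}^{(i)}-\eta_l g_{t,k+1}^{(i)}$. Then $x_{t+1}=x_t-\eta_s\cdot$(average over the miners of $x_t-x_{t,K}^{(i)}$), and $x_{t+1}=x_t$ if there is no miner. All draws are independent. **Claim.** Call the step sizes *admissible* if $\eta_s\eta_l\le\frac{1}{6\sqrt6KL\tau}$ and $\eta_l\le\min\Bigl(\frac1{6\sqrt2KL},\frac{\sqrt{b'/K}}{2\sqrt3L_\sigma}\Bigr)$.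 For all $L>0$, $\Delta$ and $c>0$ there is a constant $C>0$, depending on $L$, $\Delta$, $c$ only, such that whenever $F(x_0)-F_*\le\Delta$ and $\varepsilon>0$, one has $\min_{0\le t<T}\mathbb E\|\nabla F(x_t)\|^2\le\varepsilon$ in each of the following cases. 1. For every $b\ge1$ (in particular $b=O(1)$): with $\eta_l=\frac1K\bigl(\frac{M}{\sigma^2T}\bigr)^{1/4}$, $\eta_s=\bigl(\frac{M}{\sigma^2T}\bigr)^{1/4}$, for every $T$ so large that these are admissible and $T\ge C\tau^2\frac{\sigma^2}{M\varepsilon^2}$. That is, $T=O\bigl(\frac{\sigma^2}{M\varepsilon^2}\bigr)$ for fixed $\tau$. 2. If $b$ is of the order of $K$, in the sense that $K\le c\,b$: with $\eta_l=\frac{1}{\sqrt T K\sigma}$, $\eta_s=\sqrt{KM}$, for every $T$ so large that these are admissible and $T\ge C\tau^2\frac{\sigma^2}{MK\varepsilon^2}$. That is, $T=O\bigl(\frac{\sigma^2}{MK\varepsilon^2}\bigr)$ for fixed $\tau$. 3. If $b=\min\{n,\lceil\frac{\sigma^2}{M\varepsilon}\rceil\}$ and $K=\frac{L_\sigma^2}{6b'L^2}$: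 with $\eta_l=\frac1{6\sqrt2KL}$, $\eta_s=\frac1{\sqrt3\,\tau}$, for every $T\ge C\frac{\tau}{\varepsilon}$. That is, $T=O\bigl(\frac\tau\varepsilon\bigr)$, uniformly in $\tau$. -/

import Mathlib

open MeasureTheory ProbabilityTheory

namespace FedAMD

/-- Model parameters, gradients: vectors of `ℝ^d` with the Euclidean norm. -/
abbrev Vec (d : ℕ) := EuclideanSpace ℝ (Fin d)

/-- The data of the `M` clients: either every client holds a local dataset of the same finite
size `n`, or (streaming / online case, `n = ∞`) every client draws fresh samples from its own
distribution. -/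
inductive Data (M : ℕ) (Z : Type*) [MeasurableSpace Z] where
  | finite (n : ℕ) (sample : Fin M → Fin n → Z)
  | stream (dist : Fin M → ProbabilityMeasure Z)

namespace Data

variable {M : ℕ} {Z : Type*} [MeasurableSpace Z]

/-- The size `n` of a local dataset. -/
def size : Data M Z → ℕ∞
  | finite n _ => n
  | stream _ => ⊤

/-- The law of a single sample of client `i`. -/
noncomputable def law : Data M Z → Fin M → Measure Z
  | finite n sample, i => (n : ENNReal)⁻¹ • ∑ j : Fin n, Measure.dirac (sample i j)
  | stream dist, i => (dist i : Measure Z)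

/-- The law of a batch of `s` samples of client `i`: drawn uniformly without replacement from a
finite local dataset (so that a batch of `n` samples is the whole dataset), and independently
from the client's distribution in the streaming case. -/
noncomputable def batchLaw : Data M Z → Fin M → (s : ℕ) → Measure (Fin s → Z)
  | finite n sample, i, s =>
      (Fintype.card (Fin s ↪ Fin n) : ENNReal)⁻¹ •
        ∑ e : Fin s ↪ Fin n, Measure.dirac (fun j => sample i (e j))
  | stream dist, i, s => Measure.pi fun _ : Fin s => (dist i : Measure Z)

end Data

section Problem

variable {M d : ℕ} {Z : Type*} [MeasurableSpace Z]

/-- The gradient `∇ f_i(x, B)` of the empirical loss of client `i` on the batch `B`;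
`f i z x` is the loss of the parameters `x` on the sample `z`. -/
noncomputable def batchGrad (f : Fin M → Z → Vec d → ℝ) (i : Fin M) {s : ℕ} (B : Fin s → Z)
    (x : Vec d) : Vec d :=
  gradient (fun y => (s : ℝ)⁻¹ * ∑ j, f i (B j) y) x

/-- The local expected loss `F_i`. -/
noncomputable def localLoss (D : Data M Z) (f : Fin M → Z → Vec d → ℝ) (i : Fin M)
    (x : Vec d) : ℝ :=
  ∫ z, f i z x ∂(D.law i)

/-- The global objective `F = (1/M) ∑ F_i`. -/
noncomputable def globalLoss (D : Data M Z) (f : Fin M → Z → Vec d → ℝ) (x : Vec d) : ℝ :=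
  (M : ℝ)⁻¹ * ∑ i, localLoss D f i x

/-- The problem is well posed: sample losses are measurable in the sample, differentiable in the
parameters and have a finite expectation, and the objective is bounded below. -/
structure WellPosed (D : Data M Z) (f : Fin M → Z → Vec d → ℝ) : Prop where
  measurable : ∀ i x, Measurable fun z => f i z x
  differentiable : ∀ i z, Differentiable ℝ (f i z)
  integrable : ∀ i x, Integrable (fun z => f i z x) (D.law i)
  bddBelow : BddBelow (Set.range (globalLoss D f))

/-- `L`-smoothness of the local objectives. -/
def LSmooth (D : Data M Z) (f : Fin M → Z → Vec d → ℝ) (L : ℝ) : Prop :=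
  ∀ i, Differentiable ℝ (localLoss D f i) ∧
    ∀ v w, ‖gradient (localLoss D f i) v - gradient (localLoss D f i) w‖ ≤ L * ‖v - w‖

/-- Bounded noise: `E ‖∇f_i(v,B) - ∇F_i(v)‖² ≤ σ² / |B|`. -/
def BoundedNoise (D : Data M Z) (f : Fin M → Z → Vec d → ℝ) (σ : ℝ) : Prop :=
  ∀ (i : Fin M) (s : ℕ), 1 ≤ s → (s : ℕ∞) ≤ D.size → ∀ v,
    ∫⁻ B, ‖batchGrad f i B v - gradient (localLoss D f i) v‖ₑ ^ 2 ∂(D.batchLaw i s)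
      ≤ ENNReal.ofReal (σ ^ 2 / s)

/-- Average `L_σ`-smoothness:
`E ‖(∇f_i(v,B) - ∇f_i(w,B)) - (∇F_i(v) - ∇F_i(w))‖² ≤ (L_σ² / |B|) ‖v - w‖²`. -/
def AverageSmooth (D : Data M Z) (f : Fin M → Z → Vec d → ℝ) (Lσ : ℝ) : Prop :=
  ∀ (i : Fin M) (s : ℕ), 1 ≤ s → (s : ℕ∞) ≤ D.size → ∀ v w,
    ∫⁻ B, ‖(batchGrad f i B v - batchGrad f i B w)
        - (gradient (localLoss D f i) v - gradient (localLoss D f i) w)‖ₑ ^ 2 ∂(D.batchLaw i s)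
      ≤ ENNReal.ofReal (Lσ ^ 2 / s * ‖v - w‖ ^ 2)

end Problem

section Algorithm

variable {M d : ℕ} {Z : Type*} [MeasurableSpace Z]

/-- The randomness of one client in one round: the coin that makes it an anchor (`true`) or a
miner (`false`), its large batch of `b` samples, and its `K` small batches of `b'` samples. -/
abbrev RoundSample (Z : Type*) (b b' K : ℕ) := Bool × (Fin b → Z) × (Fin K → Fin b' → Z)

/-- The state of a miner after `k` local updates: `x_{t,k-1}`, `x_{t,k}` and `g_{t,k}`. -/
structure MinerState (d : ℕ) where
  prev : Vec d
  cur : Vec d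
  dir : Vec d

/-- The local updates of a miner, started at the global model `x` and direction `g`:
`g_{k+1} = g_k - ∇f_i(x_{k-1}, B_k) + ∇f_i(x_k, B_k)` and `x_{k+1} = x_k - η_l g_{k+1}`, where
`x_{-1} = x_0 = x` and `g_0 = g`. -/
noncomputable def minerIterate (f : Fin M → Z → Vec d → ℝ) (ηl : ℝ) (i : Fin M) {b' K : ℕ}
    (B : Fin K → Fin b' → Z) (x g : Vec d) (k : Fin (K + 1)) : MinerState d :=
  Fin.induction (motive := fun _ => MinerState d) ⟨x, x, g⟩
    (fun k s =>
      let g' := s.dir - batchGrad f i (B k) s.prev + batchGrad f i (B k) s.cur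
      ⟨s.cur, s.cur - ηl • g', g'⟩) k

/-- The change `x_t - x_{t,K}` that a miner sends to the server. -/
noncomputable def minerChange (f : Fin M → Z → Vec d → ℝ) (ηl : ℝ) (i : Fin M) {b' K : ℕ}
    (B : Fin K → Fin b' → Z) (x g : Vec d) : Vec d :=
  x - (minerIterate f ηl i B x g (Fin.last K)).cur

/-- The state of the server: the global model and the caching gradients of the clients. -/
structure ServerState (M d : ℕ) where
  model : Vec d
  cache : Fin M → Vec d

/-- One round of FedAMD with the set `A` of participating clients. -/
noncomputable def round (f : Fin M → Z → Vec d → ℝ) (ηl ηs : ℝ) {b b' K : ℕ}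
    (A : Finset (Fin M)) (ω : Fin M → RoundSample Z b b' K) (S : ServerState M d) :
    ServerState M d :=
  let g : Vec d := (M : ℝ)⁻¹ • ∑ m, S.cache m
  let miners := A.filter fun i => (ω i).1 = false
  { model :=
      if miners.Nonempty then
        S.model - ηs • ((miners.card : ℝ)⁻¹ •
          ∑ i ∈ miners, minerChange f ηl i (ω i).2.2 S.model g)
      else S.model
    cache := fun i =>
      if i ∈ A ∧ (ω i).1 = true then batchGrad f i (ω i).2.1 S.model else S.cache i }

/-- The state at the beginning of round `t` of FedAMD, as a function of the randomness `ω`, for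
the participating sets `A t`, the initial model `x₀` and the initial caching gradients `v₀`. -/
noncomputable def run (f : Fin M → Z → Vec d → ℝ) (ηl ηs : ℝ) {b b' K : ℕ}
    (A : ℕ → Finset (Fin M)) (x₀ : Vec d) (v₀ : Fin M → Vec d)
    (ω : ℕ → Fin M → RoundSample Z b b' K) : ℕ → ServerState M d
  | 0 => ⟨x₀, v₀⟩
  | t + 1 => round f ηl ηs (A t) (ω t) (run f ηl ηs A x₀ v₀ ω t)

/-- The sequential probabilities: `p_t = 1` if `τ ∣ t`, and `p_t = 0` otherwise. -/
def seqProb (τ t : ℕ) : ℝ := if t % τ = 0 then 1 else 0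

/-- The Bernoulli law with success probability `p`. -/
noncomputable def coinLaw (p : ℝ) : Measure Bool :=
  ENNReal.ofReal p • Measure.dirac true + ENNReal.ofReal (1 - p) • Measure.dirac false

/-- The law of the randomness of client `i` in a round with anchor probability `p`: coin, large
batch and small batches are independent. -/
noncomputable def roundLaw (D : Data M Z) (p : ℝ) (b b' K : ℕ) (i : Fin M) :
    Measure (RoundSample Z b b' K) :=
  (coinLaw p).prod ((D.batchLaw i b).prod (Measure.pi fun _ : Fin K => D.batchLaw i b'))

/-- `ξ t i` is the randomness of client `i` in round `t` of FedAMD with anchor probabilities `p`: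
it has the right law, and is independent over rounds and clients. -/
structure IsRandomness {Ω : Type*} [MeasurableSpace Ω] (P : Measure Ω) (D : Data M Z)
    (p : ℕ → ℝ) {b b' K : ℕ} (ξ : ℕ → Fin M → Ω → RoundSample Z b b' K) : Prop where
  hasLaw : ∀ t i, HasLaw (ξ t i) (roundLaw D (p t) b b' K i) P
  indep : iIndepFun (fun q : ℕ × Fin M => ξ q.1 q.2) P

/-- `min_{t < T} E ‖∇F(x_t)‖² ≤ ε` for FedAMD with full participation (every client takes part in
every round). -/
def ReachesWithin {Ω : Type*} [MeasurableSpace Ω] (P : Measure Ω) (D : Data M Z)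
    (f : Fin M → Z → Vec d → ℝ) (x₀ : Vec d) (v₀ : Fin M → Vec d) {b b' K : ℕ}
    (ξ : ℕ → Fin M → Ω → RoundSample Z b b' K) (ηl ηs : ℝ) (T : ℕ) (ε : ℝ) : Prop :=
  ∃ t < T, ∫⁻ ω, ‖gradient (globalLoss D f)
      (run f ηl ηs (fun _ => Finset.univ) x₀ v₀ (fun r i => ξ r i ω) t).model‖ₑ ^ 2 ∂P
    ≤ ENNReal.ofReal ε

/-- The step size constraints `η_s η_l ≤ 1 / (6√6 K L τ)` and
`η_l ≤ min (1 / (6√2 K L)) (√(b'/K) / (2√3 L_σ))`, without divisions by `L_σ` (the last bound is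
void for `L_σ = 0`). -/
def StepSizes (L Lσ : ℝ) (K τ b' : ℕ) (ηl ηs : ℝ) : Prop :=
  ηs * ηl ≤ 1 / (6 * √6 * K * L * τ) ∧ ηl ≤ 1 / (6 * √2 * K * L) ∧
    ηl * (2 * √3 * Lσ) ≤ √((b' : ℝ) / K)

end Algorithm

end FedAMD

/-! With sequential probabilities the coins are almost surely deterministic, so the run splits into
cycles: one anchor round at a model `y`, then `ρ = τ - 1` miner rounds that all use the same
averaged direction `g`. Write `G = ∇F(y)`, `η = η_s K η_l`, and let `V` bound the variance of a
large-batch gradient. Given `y`, the direction `g` has mean `G` and second moment at most `‖G‖² +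
V/M` (`anchor_moments`).

Inside a miner round, the direction of client `i` is `g + ∇F_i(x_k) - ∇F_i(x)` plus a martingale
whose increments are controlled by `‖x_k - x_{k-1}‖`. The step size constraints keep its second
moment below `9/2 ‖g‖²` through all `K` updates. Hence the displacement of the global model has
second moment at most `9/2 η² ‖g‖²`, and its mean is `-η g` up to an error `η κ ‖g‖`, where `κ² =
9/2 (L η_l K)²` (`minerChange_moments`, `miner_moments`). Local gradients enter only through
differences, so no bound on the heterogeneity of the clients is needed.

The objective is expanded only once per cycle, around `y`. The quadratic upper bound at `y`,
corrected for the rounds still to come, is a `surrogate` that is propagated backwards through the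
miner rounds (`integral_surrogate_le`, `expectAfter_miners_le`). Evaluating it at `x = y` and
averaging over `g` shows that a cycle changes the expected optimality gap by at most `-ρη(1/2 -
θ)‖G‖² + ρηθ V/M`, where `θ = 9/4 ((L η_l K)² + Lρη)` (`expectAfter_cycle_le`).

Summing over the cycles that start before `T`, with `θ < 1/5` and `τ ≤ 2ρ`, some anchor round has
expected squared gradient at most `ε` as soon as `2Δ/(ηT) + 9/4 ((L η_l K)² + Lτη) V/M ≤ 3/10 ε`
(`CycleAssumptions.reachesWithin`). In the first two cases `V = σ²/b`, and both terms are `O(τu)`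
with `u² = σ²/(MT)` and `u² = σ²/(MKT)` respectively. In the third case `V/M ≤ ε` and its
coefficient is below `3/10`, so only the first term restricts `T`. -/

namespace FedAMD

/-! ### Joint measurability of gradients and the descent inequality -/

section Calculus

variable {d : ℕ}

/-- A Carathéodory function that is differentiable in the parameter has a jointly measurable
gradient. -/
lemma measurable_gradient_uncurry {α : Type*} [MeasurableSpace α] {F : α → Vec d → ℝ}
    (hm : ∀ x, Measurable fun a => F a x) (hd : ∀ a, Differentiable ℝ (F a)) :
    Measurable fun p : α × Vec d => gradient (F p.1) p.2 := by
  have hF : Measurable fun p : α × Vec d => F p.1 p.2 :=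
    (measurable_uncurry_of_continuous_of_measurable (u := fun x a => F a x)
      (fun a => (hd a).continuous) hm).comp measurable_swap
  let e := EuclideanSpace.basisFun (Fin d) ℝ
  have hcoord : ∀ v : Vec d, Measurable fun p : α × Vec d =>
      inner ℝ v (gradient (F p.1) p.2) := by
    intro v
    -- A directional derivative is the limit of the difference quotients with increments `1/n`, each
    -- of which is jointly measurable.
    refine measurable_of_tendsto_metrizable
      (f := fun (n : ℕ) p => (n : ℝ) • (F p.1 (p.2 + (n : ℝ)⁻¹ • v) - F p.1 p.2)) ?_ ?_
    · intro n
      simp only [smul_eq_mul]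
      have h1 : Measurable fun p : α × Vec d => F p.1 (p.2 + (n : ℝ)⁻¹ • v) :=
        hF.comp (measurable_fst.prodMk (measurable_snd.add_const _))
      exact (h1.sub hF).const_mul _
    · rw [tendsto_pi_nhds]
      intro p
      rw [real_inner_comm, inner_gradient_left]
      refine ((hd p.1 p.2).hasFDerivAt).lim v (c := fun n : ℕ => (n : ℝ)) ?_
      simpa using tendsto_natCast_atTop_atTop
  have : (fun p : α × Vec d => gradient (F p.1) p.2)
      = fun p => ∑ i, inner ℝ (e i) (gradient (F p.1) p.2) • e i := by
    funext p
    exact (e.sum_repr' _).symm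
  rw [this]
  exact Finset.measurable_sum _ fun i _ => (hcoord (e i)).smul_const _

/-- The quadratic upper bound of a function with Lipschitz gradient. -/
lemma le_quadratic_of_lipschitz_gradient {F : Vec d → ℝ} {L : ℝ} (hd : Differentiable ℝ F)
    (hL : ∀ v w, ‖gradient F v - gradient F w‖ ≤ L * ‖v - w‖) (y x : Vec d) :
    F x ≤ F y + inner ℝ (gradient F y) (x - y) + L / 2 * ‖x - y‖ ^ 2 := by
  set v := x - y with hv
  have hder : ∀ t : ℝ, HasDerivAt (fun t : ℝ => F (y + t • v))
      (inner ℝ (gradient F (y + t • v)) v) t := by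
    intro t
    have h1 : HasDerivAt (fun t : ℝ => y + t • v) v t := by
      simpa using ((hasDerivAt_id t).smul_const v).const_add y
    have h2 := ((hd (y + t • v)).hasFDerivAt).comp_hasDerivAt t h1
    rw [inner_gradient_left]
    exact h2
  have hB : ∀ t : ℝ, HasDerivAt
      (fun t : ℝ => F y + t * inner ℝ (gradient F y) v + L / 2 * ‖v‖ ^ 2 * t ^ 2)
      (inner ℝ (gradient F y) v + L * ‖v‖ ^ 2 * t) t := by
    intro t
    have h1 := ((hasDerivAt_id t).mul_const (inner ℝ (gradient F y) v)).const_add (F y)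
    have h2 := ((hasDerivAt_id t).pow 2).const_mul (L / 2 * ‖v‖ ^ 2)
    refine (h1.add h2).congr_deriv ?_
    simp only [id]
    ring
  -- On the segment from `y` to `x`, `F` and the parabola agree at `t = 0`, and the derivatives are
  -- ordered by Cauchy–Schwarz and the Lipschitz bound.
  have key := image_le_of_deriv_right_le_deriv_boundary (a := 0) (b := 1)
    (f := fun t : ℝ => F (y + t • v))
    (fun t _ => (hder t).continuousAt.continuousWithinAt)
    (fun t _ => (hder t).hasDerivWithinAt)
    (B := fun t : ℝ => F y + t * inner ℝ (gradient F y) v + L / 2 * ‖v‖ ^ 2 * t ^ 2)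
    (by simp) (fun t _ => (hB t).continuousAt.continuousWithinAt)
    (fun t _ => (hB t).hasDerivWithinAt)
    (by
      intro t ht
      have h1 : inner ℝ (gradient F (y + t • v) - gradient F y) v ≤ L * ‖v‖ ^ 2 * t := by
        refine (real_inner_le_norm _ _).trans ?_
        have h2 := hL (y + t • v) y
        rw [add_sub_cancel_left, norm_smul, Real.norm_of_nonneg ht.1] at h2
        calc _ ≤ (L * (t * ‖v‖)) * ‖v‖ := by gcongr
          _ = _ := by ring
      rw [inner_sub_left] at h1
      linarith)
    (Set.right_mem_Icc.2 zero_le_one)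
  have hyv : y + (1 : ℝ) • v = x := by simp [hv]
  simp only [hyv] at key
  linarith

end Calculus

/-! ### Second moments in real and extended nonnegative form -/

section SecondMoments

variable {Ω : Type*} [MeasurableSpace Ω] {P : Measure Ω}
  {E : Type*} [NormedAddCommGroup E]

lemma integrable_sq_of_memLp {f : Ω → E} (hf : MemLp f 2 P) :
    Integrable (fun ω => ‖f ω‖ ^ 2) P :=
  (memLp_two_iff_integrable_sq_norm hf.1).1 hf

lemma integrable_inner_of_memLp {E : Type*} [NormedAddCommGroup E] [InnerProductSpace ℝ E]
    {f g : Ω → E} (hf : MemLp f 2 P) (hg : MemLp g 2 P) :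
    Integrable (fun ω => inner ℝ (f ω) (g ω)) P := by
  refine ((integrable_sq_of_memLp hf).add (integrable_sq_of_memLp hg)).mono' (hf.1.inner hg.1) ?_
  filter_upwards with ω
  simp only [Pi.add_apply]
  refine (norm_inner_le_norm _ _).trans ?_
  nlinarith [sq_nonneg (‖f ω‖ - ‖g ω‖), sq_nonneg (‖f ω‖ + ‖g ω‖)]

lemma lintegral_sq_eq_ofReal {f : Ω → E} (hf : MemLp f 2 P) :
    ∫⁻ ω, ‖f ω‖ₑ ^ 2 ∂P = ENNReal.ofReal (∫ ω, ‖f ω‖ ^ 2 ∂P) := by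
  rw [ofReal_integral_eq_lintegral_ofReal (integrable_sq_of_memLp hf)
    (Filter.Eventually.of_forall fun ω => by positivity)]
  refine lintegral_congr fun ω => ?_
  rw [ENNReal.ofReal_pow (norm_nonneg _), ofReal_norm]

lemma memLp_two_of_lintegral_sq_lt_top {f : Ω → E} (hf : AEStronglyMeasurable f P)
    (h : ∫⁻ ω, ‖f ω‖ₑ ^ 2 ∂P < ⊤) : MemLp f 2 P := by
  refine ⟨hf, ?_⟩
  rw [eLpNorm_lt_top_iff_lintegral_rpow_enorm_lt_top (by norm_num) (by norm_num)]
  simpa using h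

lemma integral_sq_le_of_lintegral_sq_le {f : Ω → E} (hf : MemLp f 2 P) {c : ℝ} (hc : 0 ≤ c)
    (h : ∫⁻ ω, ‖f ω‖ₑ ^ 2 ∂P ≤ ENNReal.ofReal c) : ∫ ω, ‖f ω‖ ^ 2 ∂P ≤ c := by
  rw [lintegral_sq_eq_ofReal hf] at h
  exact (ENNReal.ofReal_le_ofReal_iff hc).1 h

lemma sq_integral_norm_le [IsProbabilityMeasure P] {f : Ω → E} (hf : MemLp f 2 P) :
    (∫ ω, ‖f ω‖ ∂P) ^ 2 ≤ ∫ ω, ‖f ω‖ ^ 2 ∂P := by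
  have h1 : Integrable (fun ω => ‖f ω‖) P := (hf.integrable (by norm_num)).norm
  have h2 : Integrable (fun ω => ‖f ω‖ ^ 2) P := integrable_sq_of_memLp hf
  set a := ∫ ω, ‖f ω‖ ∂P with ha
  have h3 : 0 ≤ ∫ ω, (‖f ω‖ - a) ^ 2 ∂P := integral_nonneg fun ω => sq_nonneg _
  have h4 : ∫ ω, (‖f ω‖ - a) ^ 2 ∂P = ∫ ω, ‖f ω‖ ^ 2 ∂P - a ^ 2 := by
    have : ∀ ω, (‖f ω‖ - a) ^ 2 = ‖f ω‖ ^ 2 - 2 * a * ‖f ω‖ + a ^ 2 := fun ω => by ring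
    simp_rw [this]
    rw [integral_add (f := fun ω => ‖f ω‖ ^ 2 - 2 * a * ‖f ω‖) (h2.sub (h1.const_mul _))
      (integrable_const _), integral_sub h2 (h1.const_mul _), integral_const_mul, ← ha]
    simp
    ring
  linarith

lemma norm_integral_le_of_sq_le [IsProbabilityMeasure P] [NormedSpace ℝ E] {f : Ω → E}
    (hf : MemLp f 2 P) {c : ℝ} (hc : 0 ≤ c) (h : ∫ ω, ‖f ω‖ ^ 2 ∂P ≤ c ^ 2) :
    ∫ ω, ‖f ω‖ ∂P ≤ c :=
  le_of_sq_le_sq ((sq_integral_norm_le hf).trans h) hc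

end SecondMoments

/-! ### Integrating out fresh randomness; martingale differences -/

section Independence

variable {Ω : Type*} [MeasurableSpace Ω] {P : Measure Ω} [IsProbabilityMeasure P]

/-- A function of the coordinates in `S` is independent of the coordinates outside `S`. -/
lemma indepFun_of_dependsOn {ι E α : Type*} [MeasurableSpace E] [MeasurableSpace α]
    {ξ : ι → Ω → E} (h : iIndepFun ξ P) (hm : ∀ i, AEMeasurable (ξ i) P)
    {S T : Finset ι} (hST : Disjoint S T) {Y : (ι → E) → α} (hY : Measurable Y)
    (hdep : DependsOn Y (S : Set ι)) :
    IndepFun (fun ω => Y fun i => ξ i ω) (fun ω (i : T) => ξ i ω) P := by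
  classical
  have hne : Nonempty Ω := nonempty_of_isProbabilityMeasure P
  obtain ⟨ω₀⟩ := hne
  -- Coordinates outside `S` are frozen at their values in an arbitrary `ω₀`; `Y` does not see them.
  let ext : (S → E) → ι → E := fun b i => if hi : i ∈ S then b ⟨i, hi⟩ else ξ i ω₀
  have hext : Measurable ext := by
    refine measurable_pi_iff.2 fun i => ?_
    by_cases hi : i ∈ S
    · simpa [ext, hi] using measurable_pi_apply (⟨i, hi⟩ : S)
    · simp [ext, hi]
  have h1 := (h.indepFun_finset₀ S T hST hm).comp (hY.comp hext) measurable_id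
  have h2 : (fun ω => Y fun i => ξ i ω) = (Y ∘ ext) ∘ fun ω (i : S) => ξ i ω := by
    funext ω
    refine hdep fun i hi => ?_
    simp [ext, Finset.mem_coe.1 hi]
  rw [h2]
  exact h1

variable {S β E : Type*} [MeasurableSpace S] [MeasurableSpace β]

lemma map_prodMk_eq {X : Ω → S} {Z : Ω → β} {ν : Measure β} (hX : AEMeasurable X P)
    (hZ : HasLaw Z ν P) (hXZ : IndepFun X Z P) :
    P.map (fun ω => (X ω, Z ω)) = (P.map X).prod ν := by
  rw [(indepFun_iff_map_prod_eq_prod_map_map hX hZ.aemeasurable).1 hXZ, hZ.map_eq]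

lemma lintegral_comp_indep {X : Ω → S} {Z : Ω → β} {ν : Measure β} [SFinite ν]
    (hX : AEMeasurable X P) (hZ : HasLaw Z ν P) (hXZ : IndepFun X Z P) {φ : S × β → ENNReal}
    (hφ : Measurable φ) :
    ∫⁻ ω, φ (X ω, Z ω) ∂P = ∫⁻ ω, ∫⁻ b, φ (X ω, b) ∂ν ∂P := by
  rw [← lintegral_map' hφ.aemeasurable (hX.prodMk hZ.aemeasurable), map_prodMk_eq hX hZ hXZ,
    lintegral_prod _ hφ.aemeasurable,
    lintegral_map' (hφ.lintegral_prod_right').aemeasurable hX]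

lemma integral_comp_indep [NormedAddCommGroup E] [NormedSpace ℝ E]
    {X : Ω → S} {Z : Ω → β} {ν : Measure β} [SFinite ν]
    (hX : AEMeasurable X P) (hZ : HasLaw Z ν P) (hXZ : IndepFun X Z P) {φ : S × β → E}
    (hφ : StronglyMeasurable φ) (hi : Integrable (fun ω => φ (X ω, Z ω)) P) :
    ∫ ω, φ (X ω, Z ω) ∂P = ∫ ω, ∫ b, φ (X ω, b) ∂ν ∂P := by
  have hm := hX.prodMk hZ.aemeasurable
  have hi' : Integrable φ ((P.map X).prod ν) := by
    rw [← map_prodMk_eq hX hZ hXZ]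
    exact (integrable_map_measure hφ.aestronglyMeasurable hm).2 hi
  rw [← integral_map hm hφ.aestronglyMeasurable, map_prodMk_eq hX hZ hXZ,
    integral_prod _ hi', integral_map hX hφ.integral_prod_right'.aestronglyMeasurable]

/-- Moments of a martingale difference `ζ (X, Z)`, where `Z` is independent of the past `X`. -/
lemma martingaleDiff [NormedAddCommGroup E] [InnerProductSpace ℝ E] [CompleteSpace E]
    {X : Ω → S} {Z : Ω → β} {ν : Measure β} [IsProbabilityMeasure ν]
    (hX : AEMeasurable X P) (hZ : HasLaw Z ν P) (hXZ : IndepFun X Z P) {ζ : S × β → E}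
    (hζ : StronglyMeasurable ζ) {r : S → ℝ} (hr0 : ∀ s, 0 ≤ r s)
    (hr : Integrable (fun ω => r (X ω)) P)
    (hb : ∀ s, ∫⁻ b, ‖ζ (s, b)‖ₑ ^ 2 ∂ν ≤ ENNReal.ofReal (r s))
    (hζ0 : ∀ s, ∫ b, ζ (s, b) ∂ν = 0) :
    MemLp (fun ω => ζ (X ω, Z ω)) 2 P ∧
    ∫ ω, ‖ζ (X ω, Z ω)‖ ^ 2 ∂P ≤ ∫ ω, r (X ω) ∂P ∧
    ∫ ω, ζ (X ω, Z ω) ∂P = 0 ∧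
    ∀ w : S → E, StronglyMeasurable w → MemLp (fun ω => w (X ω)) 2 P →
      ∫ ω, inner ℝ (w (X ω)) (ζ (X ω, Z ω)) ∂P = 0 := by
  have hm := hX.prodMk hZ.aemeasurable
  have hae : AEStronglyMeasurable (fun ω => ζ (X ω, Z ω)) P :=
    hζ.aestronglyMeasurable.comp_aemeasurable hm
  have hle : ∫⁻ ω, ‖ζ (X ω, Z ω)‖ₑ ^ 2 ∂P ≤ ENNReal.ofReal (∫ ω, r (X ω) ∂P) := by
    rw [lintegral_comp_indep (φ := fun p => ‖ζ p‖ₑ ^ 2) hX hZ hXZ (hζ.enorm.pow_const 2),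
      ofReal_integral_eq_lintegral_ofReal hr (by filter_upwards; intro ω; exact hr0 _)]
    exact lintegral_mono fun ω => hb _
  have hmem := memLp_two_of_lintegral_sq_lt_top hae (hle.trans_lt ENNReal.ofReal_lt_top)
  refine ⟨hmem, integral_sq_le_of_lintegral_sq_le hmem (integral_nonneg fun ω => hr0 _) hle, ?_, ?_⟩
  · rw [integral_comp_indep hX hZ hXZ hζ (hmem.integrable (by norm_num))]
    simp [hζ0]
  · intro w hw hwX
    have hslice : ∀ s, Integrable (fun b => ζ (s, b)) ν := fun s =>
      (memLp_two_of_lintegral_sq_lt_top (hζ.comp_measurable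
        measurable_prodMk_left).aestronglyMeasurable
        ((hb s).trans_lt ENNReal.ofReal_lt_top)).integrable (by norm_num)
    rw [integral_comp_indep (φ := fun p => inner ℝ (w p.1) (ζ p)) hX hZ hXZ
      ((hw.comp_measurable measurable_fst).inner hζ) (integrable_inner_of_memLp hwX hmem)]
    simp [integral_inner (hslice _), hζ0]

end Independence

/-! ### Moments of a miner's local updates -/

section LocalUpdates

variable {M d : ℕ} {Z : Type*} {f : Fin M → Z → Vec d → ℝ} {i : Fin M} {b' K : ℕ} {ηl : ℝ}

lemma minerIterate_zero (B : Fin K → Fin b' → Z) (x g : Vec d) :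
    minerIterate f ηl i B x g 0 = ⟨x, x, g⟩ := rfl

lemma minerIterate_succ (B : Fin K → Fin b' → Z) (x g : Vec d) (k : Fin K) :
    minerIterate f ηl i B x g k.succ =
      ⟨(minerIterate f ηl i B x g k.castSucc).cur,
        (minerIterate f ηl i B x g k.castSucc).cur
          - ηl • ((minerIterate f ηl i B x g k.castSucc).dir
            - batchGrad f i (B k) (minerIterate f ηl i B x g k.castSucc).prev
            + batchGrad f i (B k) (minerIterate f ηl i B x g k.castSucc).cur),
        (minerIterate f ηl i B x g k.castSucc).dir
            - batchGrad f i (B k) (minerIterate f ηl i B x g k.castSucc).prev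
            + batchGrad f i (B k) (minerIterate f ηl i B x g k.castSucc).cur⟩ := rfl

/-- The state of a miner as an element of a measurable space. -/
noncomputable def minerTriple (f : Fin M → Z → Vec d → ℝ) (ηl : ℝ) (i : Fin M)
    (B : Fin K → Fin b' → Z) (x g : Vec d) (k : Fin (K + 1)) : Vec d × Vec d × Vec d :=
  ((minerIterate f ηl i B x g k).prev, (minerIterate f ηl i B x g k).cur,
    (minerIterate f ηl i B x g k).dir)

lemma minerTriple_succ (B : Fin K → Fin b' → Z) (x g : Vec d) (k : Fin K) :
    minerTriple f ηl i B x g k.succ =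
      ((minerTriple f ηl i B x g k.castSucc).2.1,
        (minerTriple f ηl i B x g k.castSucc).2.1
          - ηl • ((minerTriple f ηl i B x g k.castSucc).2.2
            - batchGrad f i (B k) (minerTriple f ηl i B x g k.castSucc).1
            + batchGrad f i (B k) (minerTriple f ηl i B x g k.castSucc).2.1),
        (minerTriple f ηl i B x g k.castSucc).2.2
            - batchGrad f i (B k) (minerTriple f ηl i B x g k.castSucc).1
            + batchGrad f i (B k) (minerTriple f ηl i B x g k.castSucc).2.1) := rfl

/-- The recursion reads `B j` only in the update from `j` to `j + 1`. This adaptedness makes the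
state before update `k` independent of `B k`. -/
lemma minerTriple_congr {B B' : Fin K → Fin b' → Z} (x g : Vec d) (k : Fin (K + 1))
    (h : ∀ j : Fin K, j.val < k.val → B j = B' j) :
    minerTriple f ηl i B x g k = minerTriple f ηl i B' x g k := by
  suffices minerIterate f ηl i B x g k = minerIterate f ηl i B' x g k by
    simp [minerTriple, this]
  induction k using Fin.induction with
  | zero => rfl
  | succ k ih =>
    have h1 := ih fun j hj => h j (by simp at hj ⊢; omega)
    rw [minerIterate_succ, minerIterate_succ, h1, h k (by simp)]

variable [MeasurableSpace Z]

lemma measurable_minerTriple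
    (hmeas : Measurable fun p : (Fin b' → Z) × Vec d => batchGrad f i p.1 p.2)
    (k : Fin (K + 1)) :
    Measurable fun p : (Fin K → Fin b' → Z) × Vec d × Vec d =>
      minerTriple f ηl i p.1 p.2.1 p.2.2 k := by
  induction k using Fin.induction with
  | zero =>
    simp only [minerTriple, minerIterate_zero]
    fun_prop
  | succ k ih =>
    have hp := ih.fst
    have hc := ih.snd.fst
    have hu := ih.snd.snd
    have hB : Measurable fun p : (Fin K → Fin b' → Z) × Vec d × Vec d => p.1 k :=
      (measurable_pi_apply k).comp measurable_fst
    have h1 := hmeas.comp (hB.prodMk hp)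
    have h2 := hmeas.comp (hB.prodMk hc)
    have hu' := (hu.sub h1).add h2
    exact hc.prodMk ((hc.sub (hu'.const_smul ηl)).prodMk hu')

lemma measurable_minerChange
    (hmeas : Measurable fun p : (Fin b' → Z) × Vec d => batchGrad f i p.1 p.2) :
    Measurable fun p : (Fin K → Fin b' → Z) × Vec d × Vec d =>
      minerChange f ηl i p.1 p.2.1 p.2.2 :=
  measurable_snd.fst.sub (measurable_minerTriple hmeas (Fin.last K)).snd.fst

/-- The deviation of a miner's direction from `g + ∇F_i(x_{k-1}) - ∇F_i(x)`. -/
noncomputable def dirError (m : Vec d → Vec d) (x g : Vec d) (s : Vec d × Vec d × Vec d) : Vec d :=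
  s.2.2 - m s.1 - (g - m x)

/-- The bounds that hold for a miner after `n` local updates, in terms of the direction `g` it
started from. -/
structure LocalBounds {Ω : Type*} [MeasurableSpace Ω] (P : Measure Ω) (m : Vec d → Vec d)
    (ηl q κ : ℝ) (x g : Vec d) (n : ℕ) (X : Ω → Vec d × Vec d × Vec d) : Prop where
  memLp_prev : MemLp (fun ω => (X ω).1 - x) 2 P
  memLp_cur : MemLp (fun ω => (X ω).2.1 - x) 2 P
  memLp_dir : MemLp (fun ω => (X ω).2.2) 2 P
  memLp_err : MemLp (fun ω => dirError m x g (X ω)) 2 P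
  dir : ∫ ω, ‖(X ω).2.2‖ ^ 2 ∂P ≤ 9 / 2 * ‖g‖ ^ 2
  step : ∫ ω, ‖(X ω).2.1 - (X ω).1‖ ^ 2 ∂P ≤ ηl ^ 2 * (9 / 2 * ‖g‖ ^ 2)
  err : ∫ ω, ‖dirError m x g (X ω)‖ ^ 2 ∂P ≤ n * (q * (ηl ^ 2 * (9 / 2 * ‖g‖ ^ 2)))
  drift : ∫ ω, ‖(X ω).2.1 - x‖ ^ 2 ∂P ≤ (n : ℝ) ^ 2 * (ηl ^ 2 * (9 / 2 * ‖g‖ ^ 2))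
  err_mean : ∫ ω, dirError m x g (X ω) ∂P = 0
  change_mean : ‖∫ ω, (x - (X ω).2.1) ∂P - (n * ηl) • g‖ ≤ n * ηl * (κ * ‖g‖)

lemma continuous_of_norm_sub_le {m : Vec d → Vec d} {L : ℝ}
    (hm : ∀ v w, ‖m v - m w‖ ≤ L * ‖v - w‖) : Continuous m :=
  (LipschitzWith.of_dist_le' (K := L) fun v w => by
    simpa only [dist_eq_norm] using hm v w).continuous

/-- Young's inequality with weight `n`, the choice that turns a drift bound proportional to `n²`
into one proportional to `(n + 1)²`. -/
lemma norm_add_sq_le_of_pos {E : Type*} [NormedAddCommGroup E] (a b : E) {n : ℝ} (hn : 0 < n) :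
    ‖a + b‖ ^ 2 ≤ (1 + 1 / n) * ‖a‖ ^ 2 + (1 + n) * ‖b‖ ^ 2 := by
  have h1 : ‖a + b‖ ^ 2 ≤ (‖a‖ + ‖b‖) ^ 2 := by gcongr; exact norm_add_le a b
  have h2 : 0 ≤ (‖a‖ - n * ‖b‖) ^ 2 / n := by positivity
  have h3 : (‖a‖ - n * ‖b‖) ^ 2 / n = ‖a‖ ^ 2 / n - 2 * ‖a‖ * ‖b‖ + n * ‖b‖ ^ 2 := by
    field_simp
    ring
  have h4 : (1 + 1 / n) * ‖a‖ ^ 2 = ‖a‖ ^ 2 + ‖a‖ ^ 2 / n := by ring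
  nlinarith

lemma norm_add_add_sq_le {E : Type*} [NormedAddCommGroup E] (a b c : E) :
    ‖a + b + c‖ ^ 2 ≤ 3 * ‖a‖ ^ 2 + 3 * ‖b‖ ^ 2 + 3 * ‖c‖ ^ 2 := by
  have h1 : ‖a + b + c‖ ^ 2 ≤ (‖a‖ + ‖b‖ + ‖c‖) ^ 2 := by gcongr; exact norm_add₃_le
  nlinarith [sq_nonneg (‖a‖ - ‖b‖), sq_nonneg (‖a‖ - ‖c‖), sq_nonneg (‖b‖ - ‖c‖)]

/-- One more local update preserves the bounds. -/
lemma LocalBounds.succ {Ω : Type*} [MeasurableSpace Ω] {P : Measure Ω} [IsProbabilityMeasure P]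
    {m : Vec d → Vec d} {q κ L : ℝ} {x g : Vec d} {n K : ℕ} {X X' : Ω → Vec d × Vec d × Vec d}
    {ζ : Ω → Vec d} (hX : LocalBounds P m ηl q κ x g n X) (hn : n + 1 ≤ K)
    (hηl : 0 ≤ ηl) (hL : 0 ≤ L) (hq : 0 ≤ q) (hκ : 0 ≤ κ)
    (hm : ∀ v w, ‖m v - m w‖ ≤ L * ‖v - w‖)
    (hLK : (L * ηl * K) ^ 2 ≤ 1 / 72) (hqK : q * ηl ^ 2 * K ≤ 1 / 12)
    (hκK : 9 / 2 * (L * ηl * K) ^ 2 ≤ κ ^ 2)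
    (hprev : ∀ ω, (X' ω).1 = (X ω).2.1)
    (hcur : ∀ ω, (X' ω).2.1 = (X ω).2.1 - ηl • (X' ω).2.2)
    (hdir : ∀ ω, (X' ω).2.2 = (X ω).2.2 + (m (X ω).2.1 - m (X ω).1) + ζ ω)
    (hζm : MemLp ζ 2 P)
    (hζ2 : ∫ ω, ‖ζ ω‖ ^ 2 ∂P ≤ ∫ ω, q * ‖(X ω).2.1 - (X ω).1‖ ^ 2 ∂P)
    (hζ0 : ∫ ω, ζ ω ∂P = 0)
    (hζe : ∫ ω, inner ℝ (dirError m x g (X ω)) (ζ ω) ∂P = 0) :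
    LocalBounds P m ηl q κ x g (n + 1) X' := by
  have hKn : ((n : ℝ) + 1) ≤ K := by exact_mod_cast hn
  have hG : 0 ≤ ‖g‖ ^ 2 := by positivity
  have herr : ∀ ω, dirError m x g (X' ω) = dirError m x g (X ω) + ζ ω := by
    intro ω
    simp only [dirError, hprev, hdir]
    abel
  -- The gradient differences telescope: beyond `g` and the accumulated noise, the direction sees
  -- only the drift from the starting point.
  have hdir' : ∀ ω, (X' ω).2.2 = g + (m (X ω).2.1 - m x) + dirError m x g (X' ω) := by
    intro ω
    simp only [dirError, hprev]
    abel
  have hmm : MemLp (fun ω => m (X ω).2.1 - m x) 2 P := by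
    refine hX.memLp_cur.of_le_mul (c := L) ?_ (Filter.Eventually.of_forall fun ω => hm _ _)
    have h1 : AEStronglyMeasurable (fun ω => ((X ω).2.1 - x) + x) P :=
      hX.memLp_cur.1.add aestronglyMeasurable_const
    simp only [sub_add_cancel] at h1
    exact ((continuous_of_norm_sub_le hm).comp_aestronglyMeasurable h1).sub
      aestronglyMeasurable_const
  have memErr : MemLp (fun ω => dirError m x g (X' ω)) 2 P := by
    simp_rw [herr]
    exact hX.memLp_err.add hζm
  have memDir : MemLp (fun ω => (X' ω).2.2) 2 P := by
    simp_rw [hdir']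
    exact ((memLp_const g).add hmm).add memErr
  have hcx : ∀ ω, (X' ω).2.1 - x = ((X ω).2.1 - x) + (-ηl) • (X' ω).2.2 := by
    intro ω
    rw [hcur, neg_smul]
    abel
  have memCur : MemLp (fun ω => (X' ω).2.1 - x) 2 P := by
    simp_rw [hcx]
    exact hX.memLp_cur.add (memDir.const_smul (-ηl))
  -- The new noise is orthogonal to the accumulated error, so the second moments add up linearly in
  -- the number of updates.
  have errSq : ∫ ω, ‖dirError m x g (X' ω)‖ ^ 2 ∂P
      ≤ ((n + 1 : ℕ) : ℝ) * (q * (ηl ^ 2 * (9 / 2 * ‖g‖ ^ 2))) := by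
    have h1 : ∀ ω, ‖dirError m x g (X' ω)‖ ^ 2 = ‖dirError m x g (X ω)‖ ^ 2
        + 2 * inner ℝ (dirError m x g (X ω)) (ζ ω) + ‖ζ ω‖ ^ 2 := fun ω => by
      rw [herr, norm_add_sq_real]
    simp_rw [h1]
    have i1 := integrable_sq_of_memLp hX.memLp_err
    have i2 := (integrable_inner_of_memLp hX.memLp_err hζm).const_mul 2
    rw [integral_add (f := fun ω => ‖dirError m x g (X ω)‖ ^ 2
        + 2 * inner ℝ (dirError m x g (X ω)) (ζ ω)) (i1.add i2) (integrable_sq_of_memLp hζm),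
      integral_add i1 i2, integral_const_mul, hζe]
    rw [integral_const_mul] at hζ2
    have := mul_le_mul_of_nonneg_left hX.step hq
    have := hX.err
    push_cast
    linarith
  have mSq : ∫ ω, ‖m (X ω).2.1 - m x‖ ^ 2 ∂P
      ≤ (L * ηl * n) ^ 2 * (9 / 2 * ‖g‖ ^ 2) := by
    calc ∫ ω, ‖m (X ω).2.1 - m x‖ ^ 2 ∂P
        ≤ ∫ ω, L ^ 2 * ‖(X ω).2.1 - x‖ ^ 2 ∂P := by
          refine integral_mono (integrable_sq_of_memLp hmm)
            ((integrable_sq_of_memLp hX.memLp_cur).const_mul _) fun ω => ?_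
          calc ‖m (X ω).2.1 - m x‖ ^ 2 ≤ (L * ‖(X ω).2.1 - x‖) ^ 2 := by
                gcongr
                exact hm _ _
            _ = _ := by ring
      _ ≤ L ^ 2 * ((n : ℝ) ^ 2 * (ηl ^ 2 * (9 / 2 * ‖g‖ ^ 2))) := by
          rw [integral_const_mul]
          exact mul_le_mul_of_nonneg_left hX.drift (sq_nonneg L)
      _ = _ := by ring
  have hLn : (L * ηl * n) ^ 2 ≤ (L * ηl * K) ^ 2 := by
    gcongr
    linarith
  -- The three-term split closes the induction: `3 + 3 · (9/2)/72 + 3 · (9/2)/12 = 69/16 ≤ 9/2`.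
  have dirSq : ∫ ω, ‖(X' ω).2.2‖ ^ 2 ∂P ≤ 9 / 2 * ‖g‖ ^ 2 := by
    have i1 := (integrable_sq_of_memLp hmm).const_mul 3
    have i2 := (integrable_sq_of_memLp memErr).const_mul 3
    have h1 : ∫ ω, ‖(X' ω).2.2‖ ^ 2 ∂P ≤ ∫ ω, (3 * ‖g‖ ^ 2 + 3 * ‖m (X ω).2.1 - m x‖ ^ 2
        + 3 * ‖dirError m x g (X' ω)‖ ^ 2) ∂P := by
      refine integral_mono (integrable_sq_of_memLp memDir)
        (((integrable_const _).add i1).add i2) fun ω => ?_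
      simp only [hdir' ω]
      exact norm_add_add_sq_le _ _ _
    rw [integral_add (f := fun ω => 3 * ‖g‖ ^ 2 + 3 * ‖m (X ω).2.1 - m x‖ ^ 2)
      ((integrable_const _).add i1) i2, integral_add (integrable_const _) i1,
      integral_const_mul (3 : ℝ) fun ω => ‖m (X ω).2.1 - m x‖ ^ 2,
      integral_const_mul (3 : ℝ) fun ω => ‖dirError m x g (X' ω)‖ ^ 2,
      integral_const, probReal_univ, one_smul] at h1
    have h2 : (L * ηl * n) ^ 2 * (9 / 2 * ‖g‖ ^ 2) ≤ 1 / 72 * (9 / 2 * ‖g‖ ^ 2) := by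
      gcongr
      exact hLn.trans hLK
    have h3 : ((n + 1 : ℕ) : ℝ) * (q * (ηl ^ 2 * (9 / 2 * ‖g‖ ^ 2)))
        ≤ 1 / 12 * (9 / 2 * ‖g‖ ^ 2) := by
      calc ((n + 1 : ℕ) : ℝ) * (q * (ηl ^ 2 * (9 / 2 * ‖g‖ ^ 2)))
          ≤ K * (q * (ηl ^ 2 * (9 / 2 * ‖g‖ ^ 2))) := by
            push_cast
            gcongr
        _ = q * ηl ^ 2 * K * (9 / 2 * ‖g‖ ^ 2) := by ring
        _ ≤ _ := by gcongr
    linarith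
  have hlin : ∫ ω, ‖m (X ω).2.1 - m x‖ ∂P ≤ κ * ‖g‖ := by
    refine norm_integral_le_of_sq_le hmm (by positivity) (mSq.trans ?_)
    calc (L * ηl * n) ^ 2 * (9 / 2 * ‖g‖ ^ 2) ≤ (L * ηl * K) ^ 2 * (9 / 2 * ‖g‖ ^ 2) := by gcongr
      _ = 9 / 2 * (L * ηl * K) ^ 2 * ‖g‖ ^ 2 := by ring
      _ ≤ κ ^ 2 * ‖g‖ ^ 2 := by gcongr
      _ = _ := by ring
  have errMean : ∫ ω, dirError m x g (X' ω) ∂P = 0 := by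
    simp_rw [herr]
    rw [integral_add (hX.memLp_err.integrable (by norm_num)) (hζm.integrable (by norm_num)),
      hX.err_mean, hζ0, add_zero]
  refine ⟨?_, memCur, memDir, memErr, dirSq, ?_, errSq, ?_, errMean, ?_⟩
  · simp_rw [hprev]
    exact hX.memLp_cur
  · have h1 : ∀ ω, ‖(X' ω).2.1 - (X' ω).1‖ ^ 2 = ηl ^ 2 * ‖(X' ω).2.2‖ ^ 2 := by
      intro ω
      rw [hcur, hprev, sub_sub_cancel_left, norm_neg, norm_smul, Real.norm_of_nonneg hηl, mul_pow]
    simp_rw [h1]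
    rw [integral_const_mul]
    gcongr
  · have iu := integrable_sq_of_memLp memDir
    have iu' : Integrable (fun ω => ηl ^ 2 * ‖(X' ω).2.2‖ ^ 2) P := iu.const_mul _
    have hu : ∫ ω, ηl ^ 2 * ‖(X' ω).2.2‖ ^ 2 ∂P ≤ ηl ^ 2 * (9 / 2 * ‖g‖ ^ 2) := by
      rw [integral_const_mul]
      gcongr
    have hsm : ∀ ω, ‖(-ηl) • (X' ω).2.2‖ ^ 2 = ηl ^ 2 * ‖(X' ω).2.2‖ ^ 2 := by
      intro ω
      rw [norm_smul, norm_neg, mul_pow, Real.norm_eq_abs, sq_abs]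
    have ic := integrable_sq_of_memLp hX.memLp_cur
    -- The weight `1 + 1/n` is useless for `n = 0`; there the previous drift vanishes almost
    -- everywhere.
    rcases Nat.eq_zero_or_pos n with rfl | hn0
    · have h0 : ∫ ω, ‖(X ω).2.1 - x‖ ^ 2 ∂P = 0 :=
        le_antisymm (by simpa using hX.drift) (integral_nonneg fun ω => by positivity)
      have h1 : ∫ ω, ‖(X' ω).2.1 - x‖ ^ 2 ∂P = ∫ ω, ηl ^ 2 * ‖(X' ω).2.2‖ ^ 2 ∂P := by
        have h2 := (integral_eq_zero_iff_of_nonneg (fun ω => by positivity) ic).1 h0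
        refine integral_congr_ae ?_
        filter_upwards [h2] with ω hω
        have h3 : (X ω).2.1 - x = 0 := by simpa using hω
        rw [hcx, h3, zero_add, hsm]
      rw [h1]
      simpa using hu
    · have hn1 : (0 : ℝ) < n := by exact_mod_cast hn0
      have h1 : ∫ ω, ‖(X' ω).2.1 - x‖ ^ 2 ∂P ≤ ∫ ω, ((1 + 1 / (n : ℝ)) * ‖(X ω).2.1 - x‖ ^ 2
          + (1 + n) * (ηl ^ 2 * ‖(X' ω).2.2‖ ^ 2)) ∂P := by
        refine integral_mono (integrable_sq_of_memLp memCur)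
          ((ic.const_mul _).add (iu'.const_mul _)) fun ω => ?_
        simp only [hcx ω, ← hsm ω]
        exact norm_add_sq_le_of_pos _ _ hn1
      rw [integral_add (ic.const_mul _) (iu'.const_mul _), integral_const_mul,
        integral_const_mul] at h1
      have h2 : (1 + 1 / (n : ℝ)) * ∫ ω, ‖(X ω).2.1 - x‖ ^ 2 ∂P
          ≤ (1 + 1 / (n : ℝ)) * ((n : ℝ) ^ 2 * (ηl ^ 2 * (9 / 2 * ‖g‖ ^ 2))) := by
        gcongr
        exact hX.drift
      have h3 : (1 + (n : ℝ)) * ∫ ω, ηl ^ 2 * ‖(X' ω).2.2‖ ^ 2 ∂P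
          ≤ (1 + (n : ℝ)) * (ηl ^ 2 * (9 / 2 * ‖g‖ ^ 2)) := by
        gcongr
      have h4 : (1 + 1 / (n : ℝ)) * ((n : ℝ) ^ 2 * (ηl ^ 2 * (9 / 2 * ‖g‖ ^ 2)))
          = ((n : ℝ) ^ 2 + n) * (ηl ^ 2 * (9 / 2 * ‖g‖ ^ 2)) := by
        field_simp
      push_cast
      calc _ ≤ ((n : ℝ) ^ 2 + n) * (ηl ^ 2 * (9 / 2 * ‖g‖ ^ 2))
            + (1 + (n : ℝ)) * (ηl ^ 2 * (9 / 2 * ‖g‖ ^ 2)) := by linarith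
        _ = _ := by ring
  · have hxc : ∀ ω, x - (X' ω).2.1 = (x - (X ω).2.1) + ηl • (X' ω).2.2 := by
      intro ω
      rw [hcur]
      abel
    have icur : Integrable (fun ω => x - (X ω).2.1) P := by
      have := (hX.memLp_cur.integrable (by norm_num)).neg
      refine this.congr (Filter.Eventually.of_forall fun ω => ?_)
      simp
    have im := hmm.integrable (q := 2) (by norm_num)
    -- The noise has mean zero, so the bias of the direction comes from the gradient drift alone.
    have h1 : ∫ ω, (X' ω).2.2 ∂P = g + ∫ ω, (m (X ω).2.1 - m x) ∂P := by
      simp_rw [hdir']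
      rw [integral_add (f := fun ω => g + (m (X ω).2.1 - m x)) ((integrable_const g).add im)
        (memErr.integrable (by norm_num)), integral_add (integrable_const g) im, errMean]
      simp
    have h2 : ∫ ω, (x - (X' ω).2.1) ∂P - (((n + 1 : ℕ) : ℝ) * ηl) • g
        = (∫ ω, (x - (X ω).2.1) ∂P - (n * ηl) • g) + ηl • ∫ ω, (m (X ω).2.1 - m x) ∂P := by
      simp_rw [hxc]
      have iu : Integrable (fun ω => ηl • (X' ω).2.2) P := (memDir.integrable (by norm_num)).smul ηl
      rw [integral_add icur iu, integral_smul, h1]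
      push_cast
      module
    rw [h2]
    refine (norm_add_le _ _).trans ?_
    have h3 : ‖ηl • ∫ ω, (m (X ω).2.1 - m x) ∂P‖ ≤ ηl * (κ * ‖g‖) := by
      rw [norm_smul, Real.norm_of_nonneg hηl]
      gcongr
      exact (norm_integral_le_integral_norm _).trans hlin
    have := hX.change_mean
    push_cast
    linarith

/-- The change sent by a miner has second moment `O((K ηl)² ‖g‖²)` and its mean is close to
`K ηl g`. -/
lemma minerChange_moments {ν : Measure (Fin b' → Z)} [IsProbabilityMeasure ν]
    {m : Vec d → Vec d} {q κ L : ℝ}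
    (hmeas : Measurable fun p : (Fin b' → Z) × Vec d => batchGrad f i p.1 p.2)
    (hηl : 0 ≤ ηl) (hL : 0 ≤ L) (hq : 0 ≤ q) (hκ : 0 ≤ κ)
    (hm : ∀ v w, ‖m v - m w‖ ≤ L * ‖v - w‖)
    (hmean : ∀ v w, ∫ B, (batchGrad f i B v - batchGrad f i B w - (m v - m w)) ∂ν = 0)
    (hvar : ∀ v w, ∫⁻ B, ‖batchGrad f i B v - batchGrad f i B w - (m v - m w)‖ₑ ^ 2 ∂ν
      ≤ ENNReal.ofReal (q * ‖v - w‖ ^ 2))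
    (hLK : (L * ηl * K) ^ 2 ≤ 1 / 72) (hqK : q * ηl ^ 2 * K ≤ 1 / 12)
    (hκK : 9 / 2 * (L * ηl * K) ^ 2 ≤ κ ^ 2) (x g : Vec d) :
    MemLp (fun B : Fin K → Fin b' → Z => minerChange f ηl i B x g) 2 (Measure.pi fun _ => ν) ∧
    ∫ B, ‖minerChange f ηl i B x g‖ ^ 2 ∂(Measure.pi fun _ : Fin K => ν)
      ≤ (K * ηl) ^ 2 * (9 / 2 * ‖g‖ ^ 2) ∧
    ‖∫ B, minerChange f ηl i B x g ∂(Measure.pi fun _ : Fin K => ν) - (K * ηl) • g‖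
      ≤ K * ηl * (κ * ‖g‖) := by
  set P : Measure (Fin K → Fin b' → Z) := Measure.pi fun _ => ν with hP
  have hcont := continuous_of_norm_sub_le hm
  have hT : ∀ k : Fin (K + 1), Measurable fun B : Fin K → Fin b' → Z =>
      minerTriple f ηl i B x g k := fun k =>
    (measurable_minerTriple hmeas k).comp
      (measurable_id.prodMk (measurable_const (a := ((x, g) : Vec d × Vec d))))
  have hind : iIndepFun (fun (k : Fin K) (B : Fin K → Fin b' → Z) => B k) P :=
    iIndepFun_pi (X := fun _ => id) fun _ => aemeasurable_id
  have hall : ∀ k : Fin (K + 1), LocalBounds P m ηl q κ x g k.val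
      fun B => minerTriple f ηl i B x g k := by
    intro k
    induction k using Fin.induction with
    | zero =>
      have h0 : ∀ B : Fin K → Fin b' → Z, minerTriple f ηl i B x g 0 = (x, x, g) := fun B => rfl
      refine ⟨?_, ?_, ?_, ?_, ?_, ?_, ?_, ?_, ?_, ?_⟩ <;>
        simp only [h0, dirError, sub_self]
      · exact MemLp.zero
      · exact MemLp.zero
      · exact memLp_const g
      · exact MemLp.zero
      · simp
        nlinarith [sq_nonneg ‖g‖]
      · simp
        positivity
      · simp
      · simp
      · simp
      · simp
    | succ k ih =>
      set X : (Fin K → Fin b' → Z) → Vec d × Vec d × Vec d :=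
        fun B => minerTriple f ηl i B x g k.castSucc with hXdef
      let ζ : (Vec d × Vec d × Vec d) × (Fin b' → Z) → Vec d := fun p =>
        batchGrad f i p.2 p.1.2.1 - batchGrad f i p.2 p.1.1 - (m p.1.2.1 - m p.1.1)
      have hζ : Measurable ζ := by
        have h1 := hmeas.comp (g := fun p : (Fin b' → Z) × Vec d => batchGrad f i p.1 p.2)
          (f := fun p : (Vec d × Vec d × Vec d) × (Fin b' → Z) => (p.2, p.1.2.1)) (by fun_prop)
        have h2 := hmeas.comp (g := fun p : (Fin b' → Z) × Vec d => batchGrad f i p.1 p.2)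
          (f := fun p : (Vec d × Vec d × Vec d) × (Fin b' → Z) => (p.2, p.1.1)) (by fun_prop)
        have h3 : Measurable fun p : (Vec d × Vec d × Vec d) × (Fin b' → Z) => m p.1.2.1 :=
          hcont.measurable.comp (by fun_prop)
        have h4 : Measurable fun p : (Vec d × Vec d × Vec d) × (Fin b' → Z) => m p.1.1 :=
          hcont.measurable.comp (by fun_prop)
        exact (h1.sub h2).sub (h3.sub h4)
      -- The state before update `k` depends only on the batches with index below `k`.
      have hindX : IndepFun X (fun B => B k) P := by
        have h1 := indepFun_of_dependsOn (S := Finset.univ.filter (· < k)) (T := {k}) hind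
          (fun j => (measurable_pi_apply j).aemeasurable) (by simp) (hT k.castSucc)
          (fun B B' hB => minerTriple_congr x g _ fun j hj => hB j (by simpa using hj))
        exact h1.comp (φ := id) (ψ := fun B : (({k} : Finset (Fin K)) → Fin b' → Z) =>
          B ⟨k, by simp⟩) measurable_id (measurable_pi_apply _)
      have hlaw : HasLaw (fun B : Fin K → Fin b' → Z => B k) ν P :=
        (measurePreserving_eval (fun _ : Fin K => ν) k).hasLaw
      have hstep : MemLp (fun B => (X B).2.1 - (X B).1) 2 P := by
        have := ih.memLp_cur.sub ih.memLp_prev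
        refine this.ae_eq (Filter.Eventually.of_forall fun B => ?_)
        simp
      obtain ⟨h1, h2, h3, h4⟩ := martingaleDiff (X := X) (Z := fun B => B k) (ζ := ζ)
        (r := fun s => q * ‖s.2.1 - s.1‖ ^ 2) (hT k.castSucc).aemeasurable hlaw hindX
        hζ.stronglyMeasurable (fun s => by positivity)
        ((integrable_sq_of_memLp hstep).const_mul q) (fun s => hvar s.2.1 s.1)
        (fun s => hmean s.2.1 s.1)
      have hw : Measurable fun s : Vec d × Vec d × Vec d => dirError m x g s := by
        have h5 : Measurable fun s : Vec d × Vec d × Vec d => m s.1 :=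
          hcont.measurable.comp measurable_fst
        exact (measurable_snd.snd.sub h5).sub_const _
      have h5 := h4 _ hw.stronglyMeasurable ih.memLp_err
      have hkK : k.val + 1 ≤ K := k.isLt
      have ih' : LocalBounds P m ηl q κ x g k.val X := ih
      refine LocalBounds.succ (ζ := fun B => ζ (X B, B k)) (X := X)
        (X' := fun B => minerTriple f ηl i B x g k.succ) (n := k.val) ih' hkK hηl hL hq
        hκ hm hLK hqK hκK ?_ ?_ ?_ h1 h2 h3 h5 <;> intro B
      · rw [minerTriple_succ]
      · rw [minerTriple_succ]
      · rw [minerTriple_succ]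
        simp only [ζ, X]
        abel
  have hlast := hall (Fin.last K)
  have hch : ∀ B : Fin K → Fin b' → Z,
      minerChange f ηl i B x g = x - (minerTriple f ηl i B x g (Fin.last K)).2.1 := fun B => rfl
  refine ⟨?_, ?_, ?_⟩
  · refine hlast.memLp_cur.neg.ae_eq (Filter.Eventually.of_forall fun B => ?_)
    simp [hch]
  · simp_rw [hch, norm_sub_rev x]
    refine hlast.drift.trans (le_of_eq ?_)
    simp
    ring
  · simpa [hch] using hlast.change_mean

end LocalUpdates

/-! ### Batches with and without replacement -/

section BatchLaw

variable {M : ℕ} {Z : Type*} [MeasurableSpace Z]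

lemma isProbabilityMeasure_batchLaw (D : Data M Z) (i : Fin M) {s : ℕ}
    (hs : (s : ℕ∞) ≤ D.size) : IsProbabilityMeasure (D.batchLaw i s) := by
  cases D with
  | finite n sample =>
    have hsn : s ≤ n := by simpa [Data.size] using hs
    have hne : Nonempty (Fin s ↪ Fin n) := ⟨Fin.castLEEmb hsn⟩
    refine ⟨?_⟩
    simp only [Data.batchLaw, Measure.smul_apply, Measure.finsetSum_apply, measure_univ,
      Finset.sum_const, Finset.card_univ, smul_eq_mul, nsmul_eq_mul, mul_one]
    exact ENNReal.inv_mul_cancel (Nat.cast_ne_zero.2 Fintype.card_ne_zero)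
      (ENNReal.natCast_ne_top _)
  | stream dist =>
    simp only [Data.batchLaw]
    infer_instance

/-- Every element is equally likely to be in a given position of a random injection. -/
lemma card_mul_sum_embedding_apply {s n : ℕ} (j : Fin s) (h : Fin n → ENNReal) :
    (n : ENNReal) * ∑ e : Fin s ↪ Fin n, h (e j)
      = (Fintype.card (Fin s ↪ Fin n) : ENNReal) * ∑ l, h l := by
  -- Cyclic shifts of `Fin n` permute the injections; averaging over all shifts lets the value at
  -- `j` run through every element equally often.
  have hshift : ∀ l : Fin n, ∑ e : Fin s ↪ Fin n, h (e j)
      = ∑ e : Fin s ↪ Fin n, h (e j + l) := by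
    intro l
    have : NeZero n := ⟨by rintro rfl; exact l.elim0⟩
    exact (Equiv.sum_comp (Equiv.embeddingCongr (Equiv.refl (Fin s)) (Equiv.addRight l))
      fun e => h (e j)).symm
  have hinner : ∀ e : Fin s ↪ Fin n, ∑ l : Fin n, h (e j + l) = ∑ l, h l := by
    intro e
    have : NeZero n := ⟨by intro h0; subst h0; exact (e j).elim0⟩
    exact Equiv.sum_comp (Equiv.addLeft (e j)) h
  calc (n : ENNReal) * ∑ e : Fin s ↪ Fin n, h (e j)
      = ∑ l : Fin n, ∑ e : Fin s ↪ Fin n, h (e j + l) := by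
        simp_rw [← hshift]
        simp
    _ = ∑ e : Fin s ↪ Fin n, ∑ l : Fin n, h (e j + l) := Finset.sum_comm
    _ = _ := by simp [hinner]

/-- Every sample of a batch has the law of a single sample. -/
lemma measurePreserving_eval_batchLaw (D : Data M Z) (i : Fin M) {s : ℕ}
    (hs : (s : ℕ∞) ≤ D.size) (j : Fin s) :
    MeasurePreserving (fun B : Fin s → Z => B j) (D.batchLaw i s) (D.law i) := by
  cases D with
  | finite n sample =>
    have hsn : s ≤ n := by simpa [Data.size] using hs
    have hne : Nonempty (Fin s ↪ Fin n) := ⟨Fin.castLEEmb hsn⟩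
    refine ⟨measurable_pi_apply j, Measure.ext fun A hA => ?_⟩
    have hA' : MeasurableSet ((fun B : Fin s → Z => B j) ⁻¹' A) := measurable_pi_apply j hA
    rw [Measure.map_apply (measurable_pi_apply j) hA]
    simp only [Data.batchLaw, Data.law, Measure.smul_apply, Measure.finsetSum_apply, smul_eq_mul,
      Measure.dirac_apply' _ hA', Measure.dirac_apply' _ hA]
    have key := card_mul_sum_embedding_apply j fun l => A.indicator (1 : Z → ENNReal) (sample i l)
    have hc0 : (Fintype.card (Fin s ↪ Fin n) : ENNReal) ≠ 0 :=
      Nat.cast_ne_zero.2 Fintype.card_ne_zero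
    have hct : (Fintype.card (Fin s ↪ Fin n) : ENNReal) ≠ ⊤ := ENNReal.natCast_ne_top _
    have hn0 : (n : ENNReal) ≠ 0 := by
      have := j.isLt
      simp
      omega
    have hnt : (n : ENNReal) ≠ ⊤ := by simp
    change _⁻¹ * ∑ e : Fin s ↪ Fin n, A.indicator (1 : Z → ENNReal) (sample i (e j)) = _
    rw [← ENNReal.mul_right_inj hn0 hnt, ← mul_assoc, mul_comm (n : ENNReal), mul_assoc, key,
      ← mul_assoc, ← mul_assoc, ENNReal.inv_mul_cancel hc0 hct, ENNReal.mul_inv_cancel hn0 hnt]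
  | stream dist =>
    exact measurePreserving_eval (fun _ : Fin s => (dist i : Measure Z)) j

end BatchLaw

/-! ### Unbiasedness of batch gradients -/

section Gradients

variable {M d : ℕ} {Z : Type*} {f : Fin M → Z → Vec d → ℝ}

lemma gradient_const_mul_sum {ι : Type*} [Fintype ι] {F : ι → Vec d → ℝ} (c : ℝ)
    (hF : ∀ j, Differentiable ℝ (F j)) (x : Vec d) :
    gradient (fun y => c * ∑ j, F j y) x = c • ∑ j, gradient (F j) x := by
  have h1 : HasFDerivAt (fun y => c * ∑ j, F j y) (c • ∑ j, fderiv ℝ (F j) x) x :=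
    (HasFDerivAt.fun_sum fun j _ => (hF j x).hasFDerivAt).const_mul c
  rw [gradient, h1.fderiv, map_smul, map_sum]
  rfl

lemma batchGrad_eq (hd : ∀ i z, Differentiable ℝ (f i z)) (i : Fin M) {s : ℕ} (B : Fin s → Z)
    (x : Vec d) : batchGrad f i B x = (s : ℝ)⁻¹ • ∑ j, gradient (f i (B j)) x :=
  gradient_const_mul_sum _ (fun j => hd i (B j)) x

variable [MeasurableSpace Z]

lemma WellPosed.measurable_gradient {D : Data M Z} (h : WellPosed D f) (i : Fin M) (x : Vec d) :
    Measurable fun z => gradient (f i z) x :=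
  (measurable_gradient_uncurry (h.measurable i) (h.differentiable i)).comp
    (measurable_id.prodMk measurable_const)

lemma WellPosed.measurable_batchGrad {D : Data M Z} (h : WellPosed D f) (i : Fin M) (s : ℕ) :
    Measurable fun p : (Fin s → Z) × Vec d => batchGrad f i p.1 p.2 := by
  simp_rw [batchGrad_eq h.differentiable]
  have hj : ∀ j : Fin s, Measurable fun p : (Fin s → Z) × Vec d => gradient (f i (p.1 j)) p.2 :=
    fun j => (measurable_gradient_uncurry (h.measurable i) (h.differentiable i)).comp
      (f := fun p : (Fin s → Z) × Vec d => (p.1 j, p.2))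
      (((measurable_pi_apply j).comp measurable_fst).prodMk measurable_snd)
  exact (Finset.measurable_sum _ fun j _ => hj j).const_smul ((s : ℝ)⁻¹)

lemma WellPosed.measurable_batchGrad_left {D : Data M Z} (h : WellPosed D f) (i : Fin M) (s : ℕ)
    (v : Vec d) : Measurable fun B : Fin s → Z => batchGrad f i B v :=
  (h.measurable_batchGrad i s).comp (f := fun B : Fin s → Z => (B, v))
    (measurable_id.prodMk measurable_const)

/-- The noise of a batch gradient has a finite second moment. -/
lemma BoundedNoise.memLp {D : Data M Z} {σ : ℝ} (hσ : BoundedNoise D f σ) (h : WellPosed D f)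
    (i : Fin M) {s : ℕ} (hs1 : 1 ≤ s) (hs : (s : ℕ∞) ≤ D.size) (v : Vec d) :
    MemLp (fun B : Fin s → Z => batchGrad f i B v - gradient (localLoss D f i) v) 2
      (D.batchLaw i s) :=
  memLp_two_of_lintegral_sq_lt_top
    ((h.measurable_batchGrad_left i s v).sub_const _).aestronglyMeasurable
    ((hσ i s hs1 hs v).trans_lt ENNReal.ofReal_lt_top)

/-- A batch of size one has the law of a single sample, so the noise bound for `s = 1` gives
integrability. -/
lemma BoundedNoise.integrable_gradient {D : Data M Z} {σ : ℝ} (hσ : BoundedNoise D f σ)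
    (h : WellPosed D f) (i : Fin M) (hs : ((1 : ℕ) : ℕ∞) ≤ D.size) (v : Vec d) :
    Integrable (fun z => gradient (f i z) v) (D.law i) := by
  have := isProbabilityMeasure_batchLaw D i hs
  have h1 := ((hσ.memLp h i le_rfl hs v).integrable (by norm_num)).add
    (integrable_const (gradient (localLoss D f i) v))
  have hmp := measurePreserving_eval_batchLaw D i hs (0 : Fin 1)
  rw [← hmp.integrable_comp (h.measurable_gradient i v).aestronglyMeasurable]
  refine h1.congr (Filter.Eventually.of_forall fun B => ?_)
  simp [batchGrad_eq h.differentiable]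

/-- Linearity of the integral suffices: every position of the batch has the single-sample law, and
dependence between positions plays no role. -/
lemma BoundedNoise.integral_batchGrad_eq_law {D : Data M Z} {σ : ℝ} (hσ : BoundedNoise D f σ)
    (h : WellPosed D f) (i : Fin M) {s : ℕ} (hs1 : 1 ≤ s) (hs : (s : ℕ∞) ≤ D.size) (v : Vec d) :
    ∫ B : Fin s → Z, batchGrad f i B v ∂(D.batchLaw i s)
      = ∫ z, gradient (f i z) v ∂(D.law i) := by
  have hi := hσ.integrable_gradient h i (le_trans (by exact_mod_cast hs1) hs) v
  have hmp := fun j => measurePreserving_eval_batchLaw D i hs j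
  have hm := (h.measurable_gradient i v).aestronglyMeasurable (μ := D.law i)
  simp_rw [batchGrad_eq h.differentiable]
  have hij : ∀ j : Fin s, Integrable (fun B : Fin s → Z => gradient (f i (B j)) v)
      (D.batchLaw i s) := fun j => (hmp j).integrable_comp_of_integrable hi
  rw [integral_smul, integral_finsetSum _ fun j _ => hij j]
  have h1 : ∀ j : Fin s, ∫ B : Fin s → Z, gradient (f i (B j)) v ∂(D.batchLaw i s)
      = ∫ z, gradient (f i z) v ∂(D.law i) := by
    intro j
    rw [← (hmp j).map_eq] at hm ⊢
    exact (integral_map (hmp j).measurable.aemeasurable hm).symm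
  simp_rw [h1]
  have hs0 : (s : ℝ) ≠ 0 := by positivity
  rw [Finset.sum_const, Finset.card_univ, Fintype.card_fin, ← Nat.cast_smul_eq_nsmul ℝ, smul_smul,
    inv_mul_cancel₀ hs0, one_smul]

lemma localLoss_finite {n : ℕ} {sample : Fin M → Fin n → Z}
    (hm : ∀ i x, Measurable fun z => f i z x) (i : Fin M) (x : Vec d) :
    localLoss (.finite n sample) f i x = (n : ℝ)⁻¹ * ∑ j, f i (sample i j) x := by
  have hint : ∀ j, Integrable (fun z => f i z x) (Measure.dirac (sample i j)) := fun j =>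
    integrable_dirac' (hm i x).stronglyMeasurable (by simp)
  simp only [localLoss, Data.law]
  rw [integral_smul_measure, integral_finsetSum_measure fun j _ => hint j]
  simp [integral_dirac' _ _ (hm i x).stronglyMeasurable]

/-- A batch gradient is unbiased. In the streaming case this follows from the noise bound for
batches of arbitrary size. -/
lemma BoundedNoise.integral_batchGrad {D : Data M Z} {σ : ℝ} (hσ : BoundedNoise D f σ)
    (h : WellPosed D f) (i : Fin M) {s : ℕ} (hs1 : 1 ≤ s) (hs : (s : ℕ∞) ≤ D.size) (v : Vec d) :
    ∫ B : Fin s → Z, batchGrad f i B v ∂(D.batchLaw i s) = gradient (localLoss D f i) v := by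
  rw [hσ.integral_batchGrad_eq_law h i hs1 hs v]
  cases D with
  | finite n sample =>
    have h1 : localLoss (.finite n sample) f i = fun x => (n : ℝ)⁻¹ * ∑ j, f i (sample i j) x :=
      funext fun x => localLoss_finite h.measurable i x
    have hmg := (h.measurable_gradient i v).stronglyMeasurable
    have hint : ∀ j, Integrable (fun z => gradient (f i z) v) (Measure.dirac (sample i j)) :=
      fun j => integrable_dirac' hmg (by simp)
    rw [h1, gradient_const_mul_sum _ fun j => h.differentiable i _]
    simp only [Data.law]
    rw [integral_smul_measure, integral_finsetSum_measure fun j _ => hint j]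
    simp [integral_dirac' _ _ hmg]
  | stream dist =>
    set D : Data M Z := .stream dist with hD
    set a := ∫ z, gradient (f i z) v ∂(D.law i) with ha
    set G := gradient (localLoss D f i) v with hG
    -- The mean `a` is the same for all batch sizes, so Jensen's inequality bounds the fixed bias by
    -- `σ²/(r + 1)` for every `r`, and it must vanish. This avoids differentiating under the
    -- integral.
    have hbias : ∀ r : ℕ, ‖a - G‖ ^ 2 ≤ σ ^ 2 / ((r + 1 : ℕ) : ℝ) := by
      intro r
      have hr1 : 1 ≤ r + 1 := by omega
      have hr : ((r + 1 : ℕ) : ℕ∞) ≤ D.size := le_top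
      have := isProbabilityMeasure_batchLaw D i hr
      have hmem := hσ.memLp h i hr1 hr v
      have hb := hσ i (r + 1) hr1 hr v
      have hsq := integral_sq_le_of_lintegral_sq_le hmem (by positivity) hb
      have hmean : ∫ B : Fin (r + 1) → Z, (batchGrad f i B v - G) ∂(D.batchLaw i (r + 1))
          = a - G := by
        have hint : Integrable (fun B : Fin (r + 1) → Z => batchGrad f i B v)
            (D.batchLaw i (r + 1)) := by
          refine ((hmem.integrable (by norm_num)).add (integrable_const G)).congr
            (Filter.Eventually.of_forall fun B => ?_)
          simp [hG]
        rw [integral_sub hint (integrable_const G), hσ.integral_batchGrad_eq_law h i hr1 hr v]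
        simp [ha]
      calc ‖a - G‖ ^ 2
          ≤ (∫ B : Fin (r + 1) → Z, ‖batchGrad f i B v - G‖ ∂(D.batchLaw i (r + 1))) ^ 2 := by
            rw [← hmean]
            gcongr
            exact norm_integral_le_integral_norm _
        _ ≤ _ := (sq_integral_norm_le hmem).trans hsq
    have hlim : Filter.Tendsto (fun r : ℕ => σ ^ 2 / ((r + 1 : ℕ) : ℝ)) Filter.atTop (nhds 0) :=
      (tendsto_const_div_atTop_nhds_zero_nat (σ ^ 2)).comp (Filter.tendsto_add_atTop_nat 1)
    have h0 : ‖a - G‖ ^ 2 ≤ 0 := ge_of_tendsto' hlim hbias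
    have h2 : ‖a - G‖ = 0 := by
      have := sq_nonneg ‖a - G‖
      exact pow_eq_zero_iff (two_ne_zero) |>.1 (le_antisymm h0 this)
    exact sub_eq_zero.1 (norm_eq_zero.1 h2)

/-- A batch that contains the whole dataset has no noise. -/
lemma lintegral_noise_full_batch {D : Data M Z} (h : WellPosed D f) (i : Fin M) {s : ℕ}
    (hs : (s : ℕ∞) = D.size) (v : Vec d) :
    ∫⁻ B : Fin s → Z, ‖batchGrad f i B v - gradient (localLoss D f i) v‖ₑ ^ 2 ∂(D.batchLaw i s)
      = 0 := by
  cases D with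
  | stream dist => exact absurd hs (by simp [Data.size])
  | finite n sample =>
    have hsn : s = n := by simpa [Data.size] using hs
    subst hsn
    have hmeas : Measurable fun B : Fin s → Z =>
        ‖batchGrad f i B v - gradient (localLoss (.finite s sample) f i) v‖ₑ ^ 2 :=
      ((h.measurable_batchGrad_left i s v).sub_const _).enorm.pow_const 2
    -- An injection of a finite set into itself is a bijection, so the batch is a reordering of the
    -- dataset.
    have hzero : ∀ e : Fin s ↪ Fin s,
        batchGrad f i (fun j => sample i (e j)) v = gradient (localLoss (.finite s sample) f i) v := by
      intro e
      have hfun : (fun y => (s : ℝ)⁻¹ * ∑ j, f i (sample i (e j)) y)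
          = localLoss (.finite s sample) f i := by
        funext y
        rw [localLoss_finite h.measurable]
        congr 1
        exact Equiv.sum_comp (Equiv.ofBijective e (Finite.injective_iff_bijective.1 e.injective))
          fun l => f i (sample i l) y
      rw [batchGrad, hfun]
    simp only [Data.batchLaw]
    rw [lintegral_smul_measure, lintegral_finsetSum_measure]
    simp [lintegral_dirac' _ hmeas, hzero]

section Global

variable {D : Data M Z} {L : ℝ}

lemma LSmooth.differentiable_globalLoss (h : LSmooth D f L) :
    Differentiable ℝ (globalLoss D f) :=
  (Differentiable.fun_sum fun i _ => (h i).1).const_mul _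

lemma LSmooth.gradient_globalLoss (h : LSmooth D f L) (x : Vec d) :
    gradient (globalLoss D f) x = (M : ℝ)⁻¹ • ∑ i, gradient (localLoss D f i) x :=
  gradient_const_mul_sum _ (fun i => (h i).1) x

lemma LSmooth.norm_gradient_globalLoss_sub_le (h : LSmooth D f L) (hM : 1 ≤ M) (v w : Vec d) :
    ‖gradient (globalLoss D f) v - gradient (globalLoss D f) w‖ ≤ L * ‖v - w‖ := by
  rw [h.gradient_globalLoss, h.gradient_globalLoss, ← smul_sub, ← Finset.sum_sub_distrib,
    norm_smul, Real.norm_of_nonneg (by positivity)]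
  have hM0 : (0 : ℝ) < M := by exact_mod_cast hM
  rw [inv_mul_le_iff₀ hM0]
  refine (norm_sum_le _ _).trans ((Finset.sum_le_sum fun i _ => (h i).2 v w).trans ?_)
  simp

end Global

end Gradients

/-! ### The law of one round -/

section RoundLaw

variable {M : ℕ} {Z : Type*} [MeasurableSpace Z]

lemma coinLaw_seqProb (τ t : ℕ) :
    coinLaw (seqProb τ t) = Measure.dirac (decide (t % τ = 0)) := by
  by_cases h : t % τ = 0 <;> simp [coinLaw, seqProb, h]

lemma isProbabilityMeasure_roundLaw (D : Data M Z) (τ t K : ℕ) {b b' : ℕ} (i : Fin M)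
    (hb : (b : ℕ∞) ≤ D.size) (hb' : (b' : ℕ∞) ≤ D.size) :
    IsProbabilityMeasure (roundLaw D (seqProb τ t) b b' K i) := by
  have := isProbabilityMeasure_batchLaw D i hb
  have := isProbabilityMeasure_batchLaw D i hb'
  rw [roundLaw, coinLaw_seqProb]
  infer_instance

/-- The law of the randomness of all clients in round `t`. -/
noncomputable def jointRoundLaw (D : Data M Z) (τ b b' K t : ℕ) :
    Measure (Fin M → RoundSample Z b b' K) :=
  Measure.pi fun i => roundLaw D (seqProb τ t) b b' K i

variable {D : Data M Z} {τ b b' K t : ℕ}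

lemma isProbabilityMeasure_jointRoundLaw (hb : (b : ℕ∞) ≤ D.size) (hb' : (b' : ℕ∞) ≤ D.size) :
    IsProbabilityMeasure (jointRoundLaw D τ b b' K t) := by
  have := fun i => isProbabilityMeasure_roundLaw D τ t K i hb hb'
  rw [jointRoundLaw]
  infer_instance

lemma measurePreserving_batches (hb : (b : ℕ∞) ≤ D.size) (hb' : (b' : ℕ∞) ≤ D.size)
    (i : Fin M) :
    MeasurePreserving (fun ω : Fin M → RoundSample Z b b' K => (ω i).2)
      (jointRoundLaw D τ b b' K t)
      ((D.batchLaw i b).prod (Measure.pi fun _ : Fin K => D.batchLaw i b')) := by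
  have h1 := fun i => isProbabilityMeasure_roundLaw D τ t K i hb hb'
  have h2 := isProbabilityMeasure_batchLaw D i hb
  have h3 := isProbabilityMeasure_batchLaw D i hb'
  have e1 := measurePreserving_eval (fun i => roundLaw D (seqProb τ t) b b' K i) i
  have e2 : MeasurePreserving (fun p : RoundSample Z b b' K => p.2)
      (roundLaw D (seqProb τ t) b b' K i)
      ((D.batchLaw i b).prod (Measure.pi fun _ : Fin K => D.batchLaw i b')) := by
    rw [roundLaw, coinLaw_seqProb]
    exact measurePreserving_snd
  exact e2.comp e1

lemma measurePreserving_largeBatch (hb : (b : ℕ∞) ≤ D.size) (hb' : (b' : ℕ∞) ≤ D.size)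
    (i : Fin M) :
    MeasurePreserving (fun ω : Fin M → RoundSample Z b b' K => (ω i).2.1)
      (jointRoundLaw D τ b b' K t) (D.batchLaw i b) := by
  have h2 := isProbabilityMeasure_batchLaw D i hb
  have h3 := isProbabilityMeasure_batchLaw D i hb'
  exact measurePreserving_fst.comp (measurePreserving_batches hb hb' i)

lemma measurePreserving_smallBatches (hb : (b : ℕ∞) ≤ D.size) (hb' : (b' : ℕ∞) ≤ D.size)
    (i : Fin M) :
    MeasurePreserving (fun ω : Fin M → RoundSample Z b b' K => (ω i).2.2)
      (jointRoundLaw D τ b b' K t) (Measure.pi fun _ : Fin K => D.batchLaw i b') := by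
  have h2 := isProbabilityMeasure_batchLaw D i hb
  have h3 := isProbabilityMeasure_batchLaw D i hb'
  exact measurePreserving_snd.comp (measurePreserving_batches hb hb' i)

end RoundLaw

/-! ### Moments of an anchor round and of a miner round -/

section Rounds

variable {M d : ℕ} {Z : Type*} [MeasurableSpace Z] {D : Data M Z} {f : Fin M → Z → Vec d → ℝ}
  {τ b b' K t : ℕ}

lemma integral_comp_measurePreserving {α β E : Type*} [MeasurableSpace α] [MeasurableSpace β]
    [NormedAddCommGroup E] [NormedSpace ℝ E] {μ : Measure α} {ν : Measure β} {T : α → β}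
    (hT : MeasurePreserving T μ ν) {F : β → E} (hF : AEStronglyMeasurable F ν) :
    ∫ a, F (T a) ∂μ = ∫ b, F b ∂ν := by
  rw [← hT.map_eq] at hF ⊢
  exact (integral_map hT.measurable.aemeasurable hF).symm

/-- The average of the large-batch gradients is unbiased, and averaging over the clients divides
the variance by `M`. -/
lemma anchor_moments {V σ : ℝ} (hM : 1 ≤ M) (hb1 : 1 ≤ b) (hb : (b : ℕ∞) ≤ D.size)
    (hb' : (b' : ℕ∞) ≤ D.size) (hwp : WellPosed D f) {L : ℝ} (hsm : LSmooth D f L)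
    (hσ : BoundedNoise D f σ) (hV : 0 ≤ V) (x : Vec d)
    (hnoise : ∀ i, ∫⁻ B : Fin b → Z, ‖batchGrad f i B x - gradient (localLoss D f i) x‖ₑ ^ 2
      ∂(D.batchLaw i b) ≤ ENNReal.ofReal V) :
    MemLp (fun ω : Fin M → RoundSample Z b b' K =>
      (M : ℝ)⁻¹ • ∑ i, batchGrad f i (ω i).2.1 x) 2 (jointRoundLaw D τ b b' K t) ∧
    ∫ ω : Fin M → RoundSample Z b b' K, (M : ℝ)⁻¹ • ∑ i, batchGrad f i (ω i).2.1 x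
      ∂(jointRoundLaw D τ b b' K t) = gradient (globalLoss D f) x ∧
    ∫ ω : Fin M → RoundSample Z b b' K, ‖(M : ℝ)⁻¹ • ∑ i, batchGrad f i (ω i).2.1 x‖ ^ 2
      ∂(jointRoundLaw D τ b b' K t) ≤ ‖gradient (globalLoss D f) x‖ ^ 2 + V / M := by
  set μ := jointRoundLaw D τ b b' K t with hμ
  have := isProbabilityMeasure_jointRoundLaw (τ := τ) (K := K) (t := t) hb hb'
  have hround := fun i => isProbabilityMeasure_roundLaw D τ t K i hb hb'
  have hbl := fun i => isProbabilityMeasure_batchLaw D i hb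
  have hM0 : (0 : ℝ) < M := by exact_mod_cast hM
  let N : (i : Fin M) → (Fin b → Z) → Vec d := fun i B =>
    batchGrad f i B x - gradient (localLoss D f i) x
  have hNm : ∀ i, Measurable (N i) := fun i =>
    (hwp.measurable_batchGrad_left i b x).sub_const _
  let n : Fin M → (Fin M → RoundSample Z b b' K) → Vec d := fun i ω => N i (ω i).2.1
  have hmp := fun i => measurePreserving_largeBatch (τ := τ) (K := K) (t := t) hb hb' i
  have hnmem : ∀ i, MemLp (n i) 2 μ := fun i =>
    (hσ.memLp hwp i hb1 hb x).comp_measurePreserving (hmp i)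
  have hn0 : ∀ i, ∫ ω, n i ω ∂μ = 0 := by
    intro i
    rw [integral_comp_measurePreserving (hmp i) (hNm i).aestronglyMeasurable]
    have hmem := hσ.memLp hwp i hb1 hb x
    have hint : Integrable (fun B : Fin b → Z => batchGrad f i B x) (D.batchLaw i b) := by
      refine ((hmem.integrable (by norm_num)).add
        (integrable_const (gradient (localLoss D f i) x))).congr
        (Filter.Eventually.of_forall fun B => ?_)
      simp
    rw [integral_sub hint (integrable_const _), hσ.integral_batchGrad hwp i hb1 hb x]
    simp
  have hnsq : ∀ i, ∫ ω, ‖n i ω‖ ^ 2 ∂μ ≤ V := by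
    intro i
    refine integral_sq_le_of_lintegral_sq_le (hnmem i) hV (le_trans (le_of_eq ?_) (hnoise i))
    exact (hmp i).lintegral_comp ((hNm i).enorm.pow_const 2)
  -- Noises of distinct clients are orthogonal: `martingaleDiff` with `n i` as the past and `n j` as
  -- the fresh randomness. Only the `M` diagonal terms survive, whence `V / M`.
  have hcross : ∀ i j, i ≠ j → ∫ ω, inner ℝ (n i ω) (n j ω) ∂μ = 0 := by
    intro i j hij
    have hmeasn : ∀ i, Measurable fun p : RoundSample Z b b' K => N i p.2.1 := fun i =>
      (hNm i).comp measurable_snd.fst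
    have hind : iIndepFun n μ :=
      iIndepFun_pi (X := fun i (p : RoundSample Z b b' K) => N i p.2.1)
        fun i => (hmeasn i).aemeasurable
    have hnm : ∀ i, Measurable (n i) := fun i => (hmeasn i).comp (measurable_pi_apply i)
    have hlaw : HasLaw (n j) (μ.map (n j)) μ := ⟨(hnm j).aemeasurable, rfl⟩
    have hprob : IsProbabilityMeasure (μ.map (n j)) :=
      Measure.isProbabilityMeasure_map (hnm j).aemeasurable
    have h := martingaleDiff (X := n i) (Z := n j) (ν := μ.map (n j))
      (ζ := fun p : Vec d × Vec d => p.2) (r := fun _ => V) (hnm i).aemeasurable hlaw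
      (hind.indepFun hij) measurable_snd.stronglyMeasurable (fun _ => hV) (integrable_const V)
      (fun s => by
        rw [lintegral_map (f := fun v : Vec d => ‖v‖ₑ ^ 2) (measurable_id.enorm.pow_const 2) (hnm j)]
        exact le_trans (le_of_eq ((hmp j).lintegral_comp ((hNm j).enorm.pow_const 2))) (hnoise j))
      (fun s => by
        rw [integral_map (f := fun v : Vec d => v) (hnm j).aemeasurable
          measurable_id.aestronglyMeasurable]
        exact hn0 j)
    exact h.2.2.2 _ stronglyMeasurable_id (hnmem i)
  set G := gradient (globalLoss D f) x with hG
  have hdecomp : ∀ ω : Fin M → RoundSample Z b b' K,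
      (M : ℝ)⁻¹ • ∑ i, batchGrad f i (ω i).2.1 x = G + (M : ℝ)⁻¹ • ∑ i, n i ω := by
    intro ω
    rw [hG, hsm.gradient_globalLoss, ← smul_add, ← Finset.sum_add_distrib]
    congr 1
    refine Finset.sum_congr rfl fun i _ => ?_
    simp [n, N]
  simp_rw [hdecomp]
  have hsum : MemLp (fun ω => ∑ i, n i ω) 2 μ := memLp_finsetSum _ fun i _ => hnmem i
  have hnoiseMem : MemLp (fun ω => (M : ℝ)⁻¹ • ∑ i, n i ω) 2 μ :=
    hsum.const_smul ((M : ℝ)⁻¹)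
  have hsum0 : ∫ ω, (M : ℝ)⁻¹ • ∑ i, n i ω ∂μ = 0 := by
    rw [integral_smul, integral_finsetSum _ fun i _ => (hnmem i).integrable (by norm_num)]
    simp [hn0]
  have hsumsq : ∫ ω, ‖∑ i, n i ω‖ ^ 2 ∂μ ≤ M * V := by
    have h1 : ∀ ω, ‖∑ i, n i ω‖ ^ 2 = ∑ i, ∑ j, inner ℝ (n i ω) (n j ω) := by
      intro ω
      rw [← real_inner_self_eq_norm_sq, sum_inner]
      simp_rw [inner_sum]
    simp_rw [h1]
    have hint : ∀ i j, Integrable (fun ω => inner ℝ (n i ω) (n j ω)) μ := fun i j =>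
      integrable_inner_of_memLp (hnmem i) (hnmem j)
    rw [integral_finsetSum _ fun i _ => integrable_finsetSum _ fun j _ => hint i j]
    have h2 : ∀ i, ∫ ω, ∑ j, inner ℝ (n i ω) (n j ω) ∂μ ≤ V := by
      intro i
      rw [integral_finsetSum _ fun j _ => hint i j,
        Finset.sum_eq_single i (fun j _ hj => hcross i j hj.symm) (by simp)]
      simp_rw [real_inner_self_eq_norm_sq]
      exact hnsq i
    refine (Finset.sum_le_sum fun i _ => h2 i).trans ?_
    simp
  refine ⟨(memLp_const G).add hnoiseMem, ?_, ?_⟩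
  · rw [integral_add (integrable_const G) (hnoiseMem.integrable (by norm_num)), hsum0]
    simp
  · have h1 : ∀ ω, ‖G + (M : ℝ)⁻¹ • ∑ i, n i ω‖ ^ 2
        = ‖G‖ ^ 2 + 2 * inner ℝ G ((M : ℝ)⁻¹ • ∑ i, n i ω)
          + (M : ℝ)⁻¹ ^ 2 * ‖∑ i, n i ω‖ ^ 2 := fun ω => by
      rw [norm_add_sq_real, norm_smul, mul_pow, Real.norm_of_nonneg (by positivity)]
    simp_rw [h1]
    have i1 : Integrable (fun ω => 2 * inner ℝ G ((M : ℝ)⁻¹ • ∑ i, n i ω)) μ :=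
      (integrable_inner_of_memLp (memLp_const G) hnoiseMem).const_mul 2
    rw [integral_add (f := fun ω => ‖G‖ ^ 2 + 2 * inner ℝ G ((M : ℝ)⁻¹ • ∑ i, n i ω))
      ((integrable_const _).add i1) ((integrable_sq_of_memLp hsum).const_mul _),
      integral_add (integrable_const _) i1, integral_const_mul, integral_const_mul,
      integral_inner (hnoiseMem.integrable (by norm_num)), hsum0]
    simp only [integral_const, probReal_univ, one_smul, inner_zero_right, mul_zero, add_zero]
    have h2 : (M : ℝ)⁻¹ ^ 2 * ∫ ω, ‖∑ i, n i ω‖ ^ 2 ∂μ ≤ (M : ℝ)⁻¹ ^ 2 * (M * V) := by gcongr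
    have h3 : (M : ℝ)⁻¹ ^ 2 * (M * V) = V / M := by field_simp
    linarith

lemma norm_sq_mean_le {E : Type*} [NormedAddCommGroup E] [NormedSpace ℝ E] (hM : 1 ≤ M)
    (v : Fin M → E) : ‖(M : ℝ)⁻¹ • ∑ i, v i‖ ^ 2 ≤ (M : ℝ)⁻¹ * ∑ i, ‖v i‖ ^ 2 := by
  have hM0 : (0 : ℝ) < M := by exact_mod_cast hM
  have h1 : ‖∑ i, v i‖ ^ 2 ≤ M * ∑ i, ‖v i‖ ^ 2 := by
    refine (pow_le_pow_left₀ (norm_nonneg _) (norm_sum_le _ _) 2).trans ?_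
    simpa using sq_sum_le_card_mul_sum_sq (s := Finset.univ) (f := fun i => ‖v i‖)
  rw [norm_smul, mul_pow, Real.norm_of_nonneg (by positivity)]
  calc (M : ℝ)⁻¹ ^ 2 * ‖∑ i, v i‖ ^ 2 ≤ (M : ℝ)⁻¹ ^ 2 * (M * ∑ i, ‖v i‖ ^ 2) := by gcongr
    _ = _ := by field_simp

/-- The displacement of the global model in a round of miners. -/
noncomputable def minerShift (f : Fin M → Z → Vec d → ℝ) (ηl ηs : ℝ) (x g : Vec d)
    (ω : Fin M → RoundSample Z b b' K) : Vec d :=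
  -(ηs • ((M : ℝ)⁻¹ • ∑ i, minerChange f ηl i (ω i).2.2 x g))

/-- Both bounds hold for each client with the same `g` and pass to the average by convexity of the
squared norm and by the triangle inequality; independence of the clients gives no gain here. -/
lemma miner_moments {L Lσ κ ηl ηs σ : ℝ} (hM : 1 ≤ M) (hb'1 : 1 ≤ b') (hb : (b : ℕ∞) ≤ D.size)
    (hb' : (b' : ℕ∞) ≤ D.size) (hwp : WellPosed D f) (hsm : LSmooth D f L)
    (hσ : BoundedNoise D f σ) (has : AverageSmooth D f Lσ) (hL : 0 ≤ L)
    (hηl : 0 ≤ ηl) (hηs : 0 ≤ ηs) (hκ : 0 ≤ κ)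
    (hLK : (L * ηl * K) ^ 2 ≤ 1 / 72) (hqK : Lσ ^ 2 / b' * ηl ^ 2 * K ≤ 1 / 12)
    (hκK : 9 / 2 * (L * ηl * K) ^ 2 ≤ κ ^ 2) (x g : Vec d) :
    MemLp (fun ω : Fin M → RoundSample Z b b' K => minerShift f ηl ηs x g ω) 2
      (jointRoundLaw D τ b b' K t) ∧
    ∫ ω : Fin M → RoundSample Z b b' K, ‖minerShift f ηl ηs x g ω‖ ^ 2
      ∂(jointRoundLaw D τ b b' K t) ≤ (ηs * (K * ηl)) ^ 2 * (9 / 2 * ‖g‖ ^ 2) ∧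
    ‖∫ ω : Fin M → RoundSample Z b b' K, minerShift f ηl ηs x g ω
      ∂(jointRoundLaw D τ b b' K t) + (ηs * (K * ηl)) • g‖
      ≤ ηs * (K * ηl) * (κ * ‖g‖) := by
  set μ := jointRoundLaw D τ b b' K t with hμ
  have := isProbabilityMeasure_jointRoundLaw (τ := τ) (K := K) (t := t) hb hb'
  have hbl := fun i => isProbabilityMeasure_batchLaw D i hb'
  have hM0 : (0 : ℝ) < M := by exact_mod_cast hM
  have hq : 0 ≤ Lσ ^ 2 / b' := by positivity
  have hmean : ∀ i v w, ∫ B : Fin b' → Z, (batchGrad f i B v - batchGrad f i B w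
      - (gradient (localLoss D f i) v - gradient (localLoss D f i) w)) ∂(D.batchLaw i b') = 0 := by
    intro i v w
    have hint : ∀ v, Integrable (fun B : Fin b' → Z => batchGrad f i B v) (D.batchLaw i b') := by
      intro v
      refine (((hσ.memLp hwp i hb'1 hb' v).integrable (by norm_num)).add
        (integrable_const (gradient (localLoss D f i) v))).congr
        (Filter.Eventually.of_forall fun B => ?_)
      simp
    rw [integral_sub (f := fun B : Fin b' → Z => batchGrad f i B v - batchGrad f i B w)
      ((hint v).sub (hint w)) (integrable_const _), integral_sub (hint v) (hint w),
      hσ.integral_batchGrad hwp i hb'1 hb' v, hσ.integral_batchGrad hwp i hb'1 hb' w]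
    simp
  have hmom := fun i => minerChange_moments (K := K) (i := i) (hwp.measurable_batchGrad i b') hηl hL
    hq hκ (hsm i).2 (hmean i) (fun v w => has i b' hb'1 hb' v w) hLK hqK hκK x g
  have hmp := fun i => measurePreserving_smallBatches (τ := τ) (K := K) (t := t) hb hb' i
  let C : Fin M → (Fin M → RoundSample Z b b' K) → Vec d := fun i ω =>
    minerChange f ηl i (ω i).2.2 x g
  have hCmeas : ∀ i, Measurable fun B : Fin K → Fin b' → Z => minerChange f ηl i B x g := fun i =>
    (measurable_minerChange (hwp.measurable_batchGrad i b')).comp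
      (f := fun B : Fin K → Fin b' → Z => (B, x, g)) (measurable_id.prodMk measurable_const)
  have hCmem : ∀ i, MemLp (C i) 2 μ := fun i => (hmom i).1.comp_measurePreserving (hmp i)
  have hCsq : ∀ i, ∫ ω, ‖C i ω‖ ^ 2 ∂μ ≤ (K * ηl) ^ 2 * (9 / 2 * ‖g‖ ^ 2) := by
    intro i
    rw [integral_comp_measurePreserving (hmp i)
      (F := fun B => ‖minerChange f ηl i B x g‖ ^ 2)
      ((hCmeas i).norm.pow_const 2).aestronglyMeasurable]
    exact (hmom i).2.1
  have hCmean : ∀ i, ‖∫ ω, C i ω ∂μ - (K * ηl) • g‖ ≤ K * ηl * (κ * ‖g‖) := by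
    intro i
    rw [integral_comp_measurePreserving (hmp i) (F := fun B => minerChange f ηl i B x g)
      (hCmeas i).aestronglyMeasurable]
    exact (hmom i).2.2
  have hsum : MemLp (fun ω => ∑ i, C i ω) 2 μ := memLp_finsetSum _ fun i _ => hCmem i
  have hmemU : MemLp (fun ω => minerShift f ηl ηs x g ω) 2 μ :=
    ((hsum.const_smul ((M : ℝ)⁻¹)).const_smul ηs).neg
  refine ⟨hmemU, ?_, ?_⟩
  · calc ∫ ω, ‖minerShift f ηl ηs x g ω‖ ^ 2 ∂μ
        ≤ ∫ ω, ηs ^ 2 * ((M : ℝ)⁻¹ * ∑ i, ‖C i ω‖ ^ 2) ∂μ := by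
          refine integral_mono (integrable_sq_of_memLp hmemU)
            (((integrable_finsetSum _ fun i _ =>
              integrable_sq_of_memLp (hCmem i)).const_mul _).const_mul _) fun ω => ?_
          simp only [minerShift]
          rw [norm_neg, norm_smul, mul_pow, Real.norm_of_nonneg hηs]
          gcongr
          exact norm_sq_mean_le hM _
      _ = ηs ^ 2 * ((M : ℝ)⁻¹ * ∑ i, ∫ ω, ‖C i ω‖ ^ 2 ∂μ) := by
          rw [integral_const_mul, integral_const_mul,
            integral_finsetSum _ fun i _ => integrable_sq_of_memLp (hCmem i)]
      _ ≤ ηs ^ 2 * ((M : ℝ)⁻¹ * ∑ i : Fin M, (K * ηl) ^ 2 * (9 / 2 * ‖g‖ ^ 2)) := by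
          gcongr with i
          exact hCsq i
      _ = _ := by
          rw [Finset.sum_const, Finset.card_univ, Fintype.card_fin, nsmul_eq_mul]
          field_simp
  · have h1 : ∫ ω, minerShift f ηl ηs x g ω ∂μ + (ηs * (K * ηl)) • g
        = -(ηs • ((M : ℝ)⁻¹ • ∑ i, (∫ ω, C i ω ∂μ - (K * ηl) • g))) := by
      have h2 : ∫ ω, minerShift f ηl ηs x g ω ∂μ
          = -(ηs • ((M : ℝ)⁻¹ • ∑ i, ∫ ω, C i ω ∂μ)) := by
        simp only [minerShift]
        rw [integral_neg, integral_smul, integral_smul,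
          integral_finsetSum _ fun i _ => (hCmem i).integrable (by norm_num)]
      rw [h2, Finset.sum_sub_distrib, Finset.sum_const, Finset.card_univ, Fintype.card_fin,
        ← Nat.cast_smul_eq_nsmul ℝ, smul_sub, smul_smul (M : ℝ)⁻¹, inv_mul_cancel₀ hM0.ne',
        one_smul]
      module
    rw [h1, norm_neg, norm_smul, norm_smul, Real.norm_of_nonneg hηs,
      Real.norm_of_nonneg (inv_nonneg.2 hM0.le), mul_assoc ηs]
    refine mul_le_mul_of_nonneg_left ?_ hηs
    rw [inv_mul_le_iff₀ hM0]
    refine (norm_sum_le _ _).trans ((Finset.sum_le_sum fun i _ => hCmean i).trans ?_)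
    simp

end Rounds

/-! ### The run as a Markov chain in the model and the averaged cache -/

section Chain

variable {M d : ℕ} {Z : Type*} {b b' K : ℕ}

/-- A round of FedAMD with sequential probabilities, as a map on the pairs of the global model and
the averaged caching gradient: all clients are anchors if `anchor` holds, and miners otherwise. -/
noncomputable def seqRound (f : Fin M → Z → Vec d → ℝ) (ηl ηs : ℝ) (anchor : Prop)
    [Decidable anchor] (ω : Fin M → RoundSample Z b b' K) (s : Vec d × Vec d) : Vec d × Vec d :=
  if anchor then (s.1, (M : ℝ)⁻¹ • ∑ i, batchGrad f i (ω i).2.1 s.1)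
  else (s.1 + minerShift f ηl ηs s.1 s.2 ω, s.2)

/-- The global model and the averaged caching gradient at the beginning of round `t`. -/
noncomputable def seqRun (f : Fin M → Z → Vec d → ℝ) (ηl ηs : ℝ) (τ : ℕ) (s₀ : Vec d × Vec d)
    (ω : ℕ → Fin M → RoundSample Z b b' K) : ℕ → Vec d × Vec d
  | 0 => s₀
  | t + 1 => seqRound f ηl ηs (t % τ = 0) (ω t) (seqRun f ηl ηs τ s₀ ω t)

variable {f : Fin M → Z → Vec d → ℝ} {ηl ηs : ℝ} {τ : ℕ}

/-- When the coins take their almost sure values, the clients are all anchors or all miners, so the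
server uses the caches only through their average. Since `M ≥ 1`, the set of miners is nonempty in a
miner round. -/
lemma run_eq_seqRun (hM : 1 ≤ M) (x₀ : Vec d) (v₀ : Fin M → Vec d)
    (ω : ℕ → Fin M → RoundSample Z b b' K) (hω : ∀ t i, (ω t i).1 = decide (t % τ = 0)) (t : ℕ) :
    seqRun f ηl ηs τ (x₀, (M : ℝ)⁻¹ • ∑ i, v₀ i) ω t
      = ((run f ηl ηs (fun _ => Finset.univ) x₀ v₀ ω t).model,
        (M : ℝ)⁻¹ • ∑ i, (run f ηl ηs (fun _ => Finset.univ) x₀ v₀ ω t).cache i) := by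
  induction t with
  | zero => rfl
  | succ t ih =>
    have : Nonempty (Fin M) := ⟨⟨0, hM⟩⟩
    rw [seqRun, ih, run]
    by_cases h : t % τ = 0
    · simp [seqRound, round, hω, h]
    · simp [seqRound, round, hω, h, minerShift, sub_eq_add_neg]

/-- Adaptedness, from which the independence of the state and the current round follows. -/
lemma seqRun_congr {s₀ : Vec d × Vec d} {ω ω' : ℕ → Fin M → RoundSample Z b b' K} (t : ℕ)
    (h : ∀ r < t, ω r = ω' r) : seqRun f ηl ηs τ s₀ ω t = seqRun f ηl ηs τ s₀ ω' t := by
  induction t with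
  | zero => rfl
  | succ t ih => rw [seqRun, seqRun, ih fun r hr => h r (by omega), h t (by omega)]

variable [MeasurableSpace Z]

lemma measurable_seqRound {D : Data M Z} (hwp : WellPosed D f) (anchor : Prop)
    [Decidable anchor] :
    Measurable fun p : (Vec d × Vec d) × (Fin M → RoundSample Z b b' K) =>
      seqRound f ηl ηs anchor p.2 p.1 := by
  have hω : ∀ i, Measurable fun p : (Vec d × Vec d) × (Fin M → RoundSample Z b b' K) => p.2 i :=
    fun i => (measurable_pi_apply i).comp measurable_snd
  by_cases h : anchor
  · simp only [seqRound, h, if_true]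
    have h1 : ∀ i, Measurable fun p : (Vec d × Vec d) × (Fin M → RoundSample Z b b' K) =>
        batchGrad f i (p.2 i).2.1 p.1.1 := fun i =>
      (hwp.measurable_batchGrad i b).comp
        (f := fun p : (Vec d × Vec d) × (Fin M → RoundSample Z b b' K) => ((p.2 i).2.1, p.1.1))
        ((hω i).snd.fst.prodMk measurable_fst.fst)
    exact measurable_fst.fst.prodMk
      ((Finset.measurable_sum _ fun i _ => h1 i).const_smul ((M : ℝ)⁻¹))
  · simp only [seqRound, h, if_false, minerShift]
    have h1 : ∀ i, Measurable fun p : (Vec d × Vec d) × (Fin M → RoundSample Z b b' K) =>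
        minerChange f ηl i (p.2 i).2.2 p.1.1 p.1.2 := fun i =>
      (measurable_minerChange (hwp.measurable_batchGrad i b')).comp
        (f := fun p : (Vec d × Vec d) × (Fin M → RoundSample Z b b' K) =>
          ((p.2 i).2.2, p.1.1, p.1.2))
        ((hω i).snd.snd.prodMk (measurable_fst.fst.prodMk measurable_fst.snd))
    exact (measurable_fst.fst.add
      (((Finset.measurable_sum _ fun i _ => h1 i).const_smul ((M : ℝ)⁻¹)).const_smul ηs).neg).prodMk
      measurable_fst.snd

/-- The expectation of `φ` after `r` more rounds, as a function of the state at the beginning of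
round `t`. -/
noncomputable def expectAfter (D : Data M Z) (f : Fin M → Z → Vec d → ℝ) (ηl ηs : ℝ)
    (τ b b' K : ℕ) (φ : Vec d × Vec d → ENNReal) : ℕ → ℕ → Vec d × Vec d → ENNReal
  | _, 0 => φ
  | t, r + 1 => fun s => ∫⁻ ω : Fin M → RoundSample Z b b' K,
      expectAfter D f ηl ηs τ b b' K φ (t + 1) r (seqRound f ηl ηs (t % τ = 0) ω s)
        ∂(jointRoundLaw D τ b b' K t)

variable {D : Data M Z}

lemma measurable_expectAfter (hwp : WellPosed D f) (hb : (b : ℕ∞) ≤ D.size)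
    (hb' : (b' : ℕ∞) ≤ D.size) {φ : Vec d × Vec d → ENNReal} (hφ : Measurable φ) (t r : ℕ) :
    Measurable (expectAfter D f ηl ηs τ b b' K φ t r) := by
  induction r generalizing t with
  | zero => exact hφ
  | succ r ih =>
    have := isProbabilityMeasure_jointRoundLaw (τ := τ) (K := K) (t := t) hb hb'
    exact ((ih (t + 1)).comp (measurable_seqRound hwp (t % τ = 0))).lintegral_prod_right'

variable {Ω : Type*} [MeasurableSpace Ω] {P : Measure Ω}
  {ξ : ℕ → Fin M → Ω → RoundSample Z b b' K} {s₀ : Vec d × Vec d}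

lemma measurable_seqRun (hwp : WellPosed D f) (t : ℕ) :
    Measurable fun e : ℕ × Fin M → RoundSample Z b b' K =>
      seqRun f ηl ηs τ s₀ (fun r i => e (r, i)) t := by
  induction t with
  | zero => exact measurable_const
  | succ t ih =>
    exact (measurable_seqRound hwp (t % τ = 0)).comp
      (ih.prodMk (measurable_pi_iff.2 fun i => measurable_pi_apply (t, i)))

lemma IsRandomness.aemeasurable_seqRun (hξ : IsRandomness P D (seqProb τ) ξ)
    (hwp : WellPosed D f) (t : ℕ) :
    AEMeasurable (fun ω => seqRun f ηl ηs τ s₀ (fun r i => ξ r i ω) t) P :=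
  (measurable_seqRun hwp t).comp_aemeasurable (f := fun ω (q : ℕ × Fin M) => ξ q.1 q.2 ω)
    (aemeasurable_pi_lambda _ fun q => (hξ.hasLaw q.1 q.2).aemeasurable)

lemma IsRandomness.hasLaw_round [IsProbabilityMeasure P]
    (hξ : IsRandomness P D (seqProb τ) ξ) (t : ℕ) :
    HasLaw (fun ω i => ξ t i ω) (jointRoundLaw D τ b b' K t) P := by
  have hm := fun i => (hξ.hasLaw t i).aemeasurable
  refine ⟨aemeasurable_pi_lambda _ hm, ?_⟩
  have h1 : iIndepFun (fun i => ξ t i) P :=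
    hξ.indep.precomp (g := fun i : Fin M => (t, i)) fun i j hij => by simpa using hij
  rw [(iIndepFun_iff_map_fun_eq_pi_map hm).1 h1, jointRoundLaw]
  congr 1
  funext i
  exact (hξ.hasLaw t i).map_eq

lemma IsRandomness.indepFun_seqRun [IsProbabilityMeasure P]
    (hξ : IsRandomness P D (seqProb τ) ξ)
    (hwp : WellPosed D f) (t : ℕ) :
    IndepFun (fun ω => seqRun f ηl ηs τ s₀ (fun r i => ξ r i ω) t) (fun ω i => ξ t i ω) P := by
  have h1 := indepFun_of_dependsOn (S := Finset.range t ×ˢ (Finset.univ : Finset (Fin M)))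
    (T := {t} ×ˢ (Finset.univ : Finset (Fin M))) hξ.indep
    (fun q => (hξ.hasLaw q.1 q.2).aemeasurable)
    (by
      rw [Finset.disjoint_left]
      intro q hq hq'
      simp only [Finset.mem_product, Finset.mem_range, Finset.mem_singleton] at hq hq'
      omega)
    (measurable_seqRun (f := f) (ηl := ηl) (ηs := ηs) (τ := τ) (s₀ := s₀) hwp t)
    (fun e e' he => seqRun_congr t fun r hr => funext fun i => he (r, i) (by simpa using hr))
  exact h1.comp (φ := id)
    (ψ := fun (e : (({t} ×ˢ (Finset.univ : Finset (Fin M)) : Finset (ℕ × Fin M))) →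
      RoundSample Z b b' K) (i : Fin M) => e ⟨(t, i), by simp⟩)
    measurable_id (measurable_pi_iff.2 fun i => measurable_pi_apply _)

/-- The Markov property. -/
lemma IsRandomness.lintegral_seqRun_add [IsProbabilityMeasure P]
    (hξ : IsRandomness P D (seqProb τ) ξ)
    (hwp : WellPosed D f) (hb : (b : ℕ∞) ≤ D.size) (hb' : (b' : ℕ∞) ≤ D.size)
    {φ : Vec d × Vec d → ENNReal} (hφ : Measurable φ) (t r : ℕ) :
    ∫⁻ ω, φ (seqRun f ηl ηs τ s₀ (fun r i => ξ r i ω) (t + r)) ∂P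
      = ∫⁻ ω, expectAfter D f ηl ηs τ b b' K φ t r
          (seqRun f ηl ηs τ s₀ (fun r i => ξ r i ω) t) ∂P := by
  induction r generalizing t with
  | zero => rfl
  | succ r ih =>
    have := isProbabilityMeasure_jointRoundLaw (τ := τ) (K := K) (t := t) hb hb'
    rw [show t + (r + 1) = t + 1 + r by omega, ih (t + 1)]
    exact lintegral_comp_indep
      (φ := fun p : (Vec d × Vec d) × (Fin M → RoundSample Z b b' K) =>
        expectAfter D f ηl ηs τ b b' K φ (t + 1) r (seqRound f ηl ηs (t % τ = 0) p.2 p.1))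
      (hξ.aemeasurable_seqRun hwp t) (hξ.hasLaw_round t) (hξ.indepFun_seqRun hwp t)
      ((measurable_expectAfter hwp hb hb' hφ (t + 1) r).comp (measurable_seqRound hwp _))

lemma IsRandomness.ae_coin (hξ : IsRandomness P D (seqProb τ) ξ) (hb : (b : ℕ∞) ≤ D.size)
    (hb' : (b' : ℕ∞) ≤ D.size) :
    ∀ᵐ ω ∂P, ∀ t i, (ξ t i ω).1 = decide (t % τ = 0) := by
  refine ae_all_iff.2 fun t => ae_all_iff.2 fun i => ?_
  have h1 := isProbabilityMeasure_batchLaw D i hb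
  have h2 := isProbabilityMeasure_batchLaw D i hb'
  have hmp : MeasurePreserving (fun p : RoundSample Z b b' K => p.1)
      (roundLaw D (seqProb τ t) b b' K i) (Measure.dirac (decide (t % τ = 0))) := by
    rw [roundLaw, coinLaw_seqProb]
    exact measurePreserving_fst
  have h3 : ∀ᵐ p ∂(roundLaw D (seqProb τ t) b b' K i), p.1 = decide (t % τ = 0) :=
    hmp.quasiMeasurePreserving.ae (p := fun c => c = decide (t % τ = 0)) (by simp)
  rw [← (hξ.hasLaw t i).map_eq] at h3
  exact ae_of_ae_map (hξ.hasLaw t i).aemeasurable h3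

end Chain

/-! ### Backward propagation of the quadratic bound -/

section Surrogate

variable {d : ℕ}

/-- An upper bound of the expected optimality gap after `r` rounds of miners, started at `x` with
direction `g`; `c₀` and `G` are the optimality gap and the gradient at the anchor `y`. -/
noncomputable def surrogate (c₀ L η κ β : ℝ) (y G g : Vec d) (r : ℕ) (x : Vec d) : ℝ :=
  c₀ + inner ℝ G (x - y) + r * (η * (κ * (‖G‖ * ‖g‖) - inner ℝ G g))
    + L / 2 * (‖x - y‖ + r * (β * ‖g‖)) ^ 2

variable {Ω : Type*} [MeasurableSpace Ω] {μ : Measure Ω} [IsProbabilityMeasure μ]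
  {c₀ L η κ β : ℝ} {y G g : Vec d}

lemma integrable_surrogate (r : ℕ) (x : Vec d) {U : Ω → Vec d} (hU : MemLp U 2 μ) :
    Integrable (fun ω => surrogate c₀ L η κ β y G g r (x + U ω)) μ := by
  have hx : MemLp (fun ω => x + U ω - y) 2 μ := ((memLp_const x).add hU).sub (memLp_const y)
  have h1 : Integrable (fun ω => inner ℝ G (x + U ω - y)) μ :=
    integrable_inner_of_memLp (memLp_const G) hx
  have h2 : MemLp (fun ω => ‖x + U ω - y‖ + r * (β * ‖g‖)) 2 μ := hx.norm.add (memLp_const _)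
  exact (((integrable_const c₀).add h1).add (integrable_const _)).add (h2.integrable_sq.const_mul _)

/-- The linear part averages to `inner G (E U)`, which the bias bound puts below `η (κ ‖G‖ ‖g‖ -
inner G g)`. In the quadratic part `‖x - y‖` grows by at most `‖U‖`, whose first two moments are at
most `B` and `B²`, so `E (a + ‖U‖)² ≤ (a + B)²`. Keeping the future displacements inside the square
makes the bound reproduce itself without any information on correlations between rounds. -/
lemma integral_surrogate_le (hL : 0 ≤ L) (hβ : 0 ≤ β) (r : ℕ) (x : Vec d) {U : Ω → Vec d}
    (hU : MemLp U 2 μ) (hU2 : ∫ ω, ‖U ω‖ ^ 2 ∂μ ≤ (β * ‖g‖) ^ 2)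
    (hU1 : ‖∫ ω, U ω ∂μ + η • g‖ ≤ η * (κ * ‖g‖)) :
    ∫ ω, surrogate c₀ L η κ β y G g r (x + U ω) ∂μ ≤ surrogate c₀ L η κ β y G g (r + 1) x := by
  set B := β * ‖g‖ with hB
  have hB0 : 0 ≤ B := by positivity
  set a := ‖x - y‖ + r * B with ha
  have ha0 : 0 ≤ a := by positivity
  set e := c₀ + inner ℝ G (x - y) + r * (η * (κ * (‖G‖ * ‖g‖) - inner ℝ G g)) with he
  have iU := hU.integrable (q := 2) (by norm_num)
  have iG : Integrable (fun ω => inner ℝ G (U ω)) μ :=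
    integrable_inner_of_memLp (memLp_const G) hU
  have iN : Integrable (fun ω => L / 2 * (2 * a * ‖U ω‖)) μ := (iU.norm.const_mul _).const_mul _
  have iS : Integrable (fun ω => L / 2 * ‖U ω‖ ^ 2) μ := (integrable_sq_of_memLp hU).const_mul _
  have iC : Integrable (fun _ : Ω => e + L / 2 * a ^ 2) μ := integrable_const _
  have hpt : ∀ ω, surrogate c₀ L η κ β y G g r (x + U ω)
      ≤ e + L / 2 * a ^ 2 + inner ℝ G (U ω) + L / 2 * (2 * a * ‖U ω‖) + L / 2 * ‖U ω‖ ^ 2 := by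
    intro ω
    have h1 : x + U ω - y = (x - y) + U ω := by abel
    have h2 : (‖(x - y) + U ω‖ + r * B) ^ 2 ≤ (a + ‖U ω‖) ^ 2 := by
      have := norm_add_le (x - y) (U ω)
      refine pow_le_pow_left₀ (by positivity) ?_ 2
      rw [ha]
      linarith
    have h3 := mul_le_mul_of_nonneg_left h2 (by positivity : 0 ≤ L / 2)
    simp only [surrogate, h1, inner_add_right]
    linarith
  have hint : ∫ ω, surrogate c₀ L η κ β y G g r (x + U ω) ∂μ
      ≤ e + L / 2 * a ^ 2 + inner ℝ G (∫ ω, U ω ∂μ) + L / 2 * (2 * a * ∫ ω, ‖U ω‖ ∂μ)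
        + L / 2 * ∫ ω, ‖U ω‖ ^ 2 ∂μ := by
    have hI : Integrable (fun ω => e + L / 2 * a ^ 2 + inner ℝ G (U ω)
        + L / 2 * (2 * a * ‖U ω‖) + L / 2 * ‖U ω‖ ^ 2) μ := ((iC.add iG).add iN).add iS
    refine (integral_mono (integrable_surrogate r x hU) hI hpt).trans (le_of_eq ?_)
    rw [integral_add (f := fun ω => e + L / 2 * a ^ 2 + inner ℝ G (U ω)
        + L / 2 * (2 * a * ‖U ω‖)) ((iC.add iG).add iN) iS,
      integral_add (f := fun ω => e + L / 2 * a ^ 2 + inner ℝ G (U ω)) (iC.add iG) iN,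
      integral_add iC iG, integral_inner iU, integral_const_mul, integral_const_mul,
      integral_const_mul]
    simp
  have hN : ∫ ω, ‖U ω‖ ∂μ ≤ B := norm_integral_le_of_sq_le hU hB0 hU2
  have hG : inner ℝ G (∫ ω, U ω ∂μ) ≤ η * (κ * (‖G‖ * ‖g‖) - inner ℝ G g) := by
    have h1 : inner ℝ G (∫ ω, U ω ∂μ) = inner ℝ G (∫ ω, U ω ∂μ + η • g) - η * inner ℝ G g := by
      rw [inner_add_right, real_inner_smul_right]
      ring
    have h2 := (real_inner_le_norm G (∫ ω, U ω ∂μ + η • g)).trans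
      (mul_le_mul_of_nonneg_left hU1 (norm_nonneg G))
    rw [h1]
    linarith
  have h4 : L / 2 * (2 * a * ∫ ω, ‖U ω‖ ∂μ) ≤ L / 2 * (2 * a * B) := by gcongr
  have h5 : L / 2 * ∫ ω, ‖U ω‖ ^ 2 ∂μ ≤ L / 2 * B ^ 2 := by gcongr
  have h6 : surrogate c₀ L η κ β y G g (r + 1) x
      = e + η * (κ * (‖G‖ * ‖g‖) - inner ℝ G g) + L / 2 * (a + B) ^ 2 := by
    simp only [surrogate, he, ha]
    push_cast
    ring
  rw [h6]
  linarith [hint]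

end Surrogate

/-! ### Decrease of the optimality gap over one cycle -/

section Cycle

variable {M d : ℕ} {Z : Type*} [MeasurableSpace Z]

/-- The assumptions on the problem and the step sizes that the analysis of a cycle uses. -/
structure CycleAssumptions (D : Data M Z) (f : Fin M → Z → Vec d → ℝ) (b b' K : ℕ)
    (L Lσ σ V ηl ηs : ℝ) : Prop where
  one_le_clients : 1 ≤ M
  one_le_b : 1 ≤ b
  one_le_b' : 1 ≤ b'
  b_le : (b : ℕ∞) ≤ D.size
  b'_le : (b' : ℕ∞) ≤ D.size
  wellPosed : WellPosed D f
  smooth : LSmooth D f L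
  boundedNoise : BoundedNoise D f σ
  averageSmooth : AverageSmooth D f Lσ
  noise : ∀ i x, ∫⁻ B : Fin b → Z, ‖batchGrad f i B x - gradient (localLoss D f i) x‖ₑ ^ 2
      ∂(D.batchLaw i b) ≤ ENNReal.ofReal V
  L_nonneg : 0 ≤ L
  V_nonneg : 0 ≤ V
  ηl_nonneg : 0 ≤ ηl
  ηs_nonneg : 0 ≤ ηs
  smallLocal : (L * ηl * K) ^ 2 ≤ 1 / 72
  smallNoise : Lσ ^ 2 / b' * ηl ^ 2 * K ≤ 1 / 12

/-- The optimality gap `F(x) - F_*`. -/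
noncomputable def gap (D : Data M Z) (f : Fin M → Z → Vec d → ℝ) (x : Vec d) : ℝ :=
  globalLoss D f x - ⨅ z, globalLoss D f z

lemma WellPosed.gap_nonneg {D : Data M Z} {f : Fin M → Z → Vec d → ℝ} (h : WellPosed D f)
    (x : Vec d) : 0 ≤ gap D f x :=
  sub_nonneg.2 (ciInf_le h.bddBelow x)

namespace CycleAssumptions

variable {D : Data M Z} {f : Fin M → Z → Vec d → ℝ} {b b' K τ : ℕ} {L Lσ σ V ηl ηs : ℝ}

/-- Backward induction on the remaining miner rounds, with `y` and `g` fixed and `x` arbitrary: for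
`r = 0` it is the quadratic upper bound at `y`, and `integral_surrogate_le` is the induction step.
Nonnegativity is carried along so that the integral commutes with `ENNReal.ofReal`. -/
lemma expectAfter_miners_le (h : CycleAssumptions D f b b' K L Lσ σ V ηl ηs) {κ β : ℝ}
    (hκ : 0 ≤ κ) (hβ : 0 ≤ β) (hκK : κ ^ 2 = 9 / 2 * (L * ηl * K) ^ 2)
    (hβη : β ^ 2 = 9 / 2 * (ηs * (K * ηl)) ^ 2) (y g : Vec d) (r t : ℕ)
    (ht : ∀ j < r, (t + j) % τ ≠ 0) (x : Vec d) :
    0 ≤ surrogate (gap D f y) L (ηs * (K * ηl)) κ β y (gradient (globalLoss D f) y) g r x ∧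
    expectAfter D f ηl ηs τ b b' K (fun s => ENNReal.ofReal (gap D f s.1)) t r (x, g)
      ≤ ENNReal.ofReal (surrogate (gap D f y) L (ηs * (K * ηl)) κ β y
          (gradient (globalLoss D f) y) g r x) := by
  induction r generalizing t x with
  | zero =>
    have h1 : gap D f x ≤ surrogate (gap D f y) L (ηs * (K * ηl)) κ β y
        (gradient (globalLoss D f) y) g 0 x := by
      have h2 := le_quadratic_of_lipschitz_gradient h.smooth.differentiable_globalLoss
        (h.smooth.norm_gradient_globalLoss_sub_le h.one_le_clients) y x
      simp only [surrogate, gap, Nat.cast_zero, zero_mul, add_zero]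
      linarith
    exact ⟨(h.wellPosed.gap_nonneg x).trans h1, ENNReal.ofReal_le_ofReal h1⟩
  | succ r ih =>
    have hprob := isProbabilityMeasure_jointRoundLaw (τ := τ) (K := K) (t := t) h.b_le h.b'_le
    obtain ⟨hU, hU2, hU1⟩ := miner_moments (τ := τ) (t := t) h.one_le_clients h.one_le_b' h.b_le
      h.b'_le h.wellPosed h.smooth h.boundedNoise h.averageSmooth h.L_nonneg h.ηl_nonneg
      h.ηs_nonneg hκ h.smallLocal h.smallNoise hκK.ge x g
    have hU2' : (ηs * (K * ηl)) ^ 2 * (9 / 2 * ‖g‖ ^ 2) = (β * ‖g‖) ^ 2 := by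
      rw [mul_pow β, hβη]
      ring
    rw [hU2'] at hU2
    have ih' := ih (t + 1) fun j hj => by
      have := ht (j + 1) (by omega)
      rwa [show t + 1 + j = t + (j + 1) by omega]
    have hle := integral_surrogate_le (c₀ := gap D f y) (y := y)
      (G := gradient (globalLoss D f) y) h.L_nonneg hβ r x hU hU2 hU1
    refine ⟨(integral_nonneg fun ω => (ih' _).1).trans hle, ?_⟩
    have h0 : t % τ ≠ 0 := by simpa using ht 0 (by omega)
    simp only [expectAfter, seqRound, h0, if_false]
    calc _ ≤ ∫⁻ ω : Fin M → RoundSample Z b b' K, ENNReal.ofReal (surrogate (gap D f y) L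
              (ηs * (K * ηl)) κ β y (gradient (globalLoss D f) y) g r
              (x + minerShift f ηl ηs x g ω)) ∂(jointRoundLaw D τ b b' K t) :=
          lintegral_mono fun ω => (ih' _).2
      _ = ENNReal.ofReal (∫ ω : Fin M → RoundSample Z b b' K, surrogate (gap D f y) L
              (ηs * (K * ηl)) κ β y (gradient (globalLoss D f) y) g r
              (x + minerShift f ηl ηs x g ω) ∂(jointRoundLaw D τ b b' K t)) :=
          (ofReal_integral_eq_lintegral_ofReal (integrable_surrogate r x hU)
            (Filter.Eventually.of_forall fun ω => (ih' _).1)).symm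
      _ ≤ _ := ENNReal.ofReal_le_ofReal hle

/-- The decrease of the expected optimality gap over a cycle of one round of anchors and `ρ`
rounds of miners. -/
lemma expectAfter_cycle_le (h : CycleAssumptions D f b b' K L Lσ σ V ηl ηs) {ρ : ℕ} {η θ : ℝ}
    (hη : η = ηs * (K * ηl)) (hθ : θ = 9 / 4 * ((L * ηl * K) ^ 2 + L * (ρ * η)))
    (hθ2 : θ ≤ 1 / 2) (j : ℕ) (s : Vec d × Vec d) :
    expectAfter D f ηl ηs (ρ + 1) b b' K (fun s => ENNReal.ofReal (gap D f s.1))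
        (j * (ρ + 1)) (ρ + 1) s
      + ENNReal.ofReal (ρ * η * (1 / 2 - θ) * ‖gradient (globalLoss D f) s.1‖ ^ 2)
      ≤ ENNReal.ofReal (gap D f s.1) + ENNReal.ofReal (ρ * η * (θ * (V / M))) := by
  obtain ⟨y, g₀⟩ := s
  have hη0 : 0 ≤ η := by
    rw [hη]
    have := h.ηs_nonneg
    have := h.ηl_nonneg
    positivity
  have hL := h.L_nonneg
  have hV : 0 ≤ V / M := div_nonneg h.V_nonneg (Nat.cast_nonneg M)
  have hθ0 : 0 ≤ θ := by
    rw [hθ]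
    positivity
  set G := gradient (globalLoss D f) y with hG
  set κ := √(9 / 2) * (L * ηl * K) with hκ
  set β := √(9 / 2) * η with hβ
  have hκ0 : 0 ≤ κ := by
    have := h.ηl_nonneg
    positivity
  have hβ0 : 0 ≤ β := by positivity
  have hκK : κ ^ 2 = 9 / 2 * (L * ηl * K) ^ 2 := by
    rw [hκ, mul_pow, Real.sq_sqrt (by norm_num)]
  have hβη : β ^ 2 = 9 / 2 * η ^ 2 := by rw [hβ, mul_pow, Real.sq_sqrt (by norm_num)]
  set t := j * (ρ + 1) with ht
  have hmiss : ∀ i < ρ, (t + 1 + i) % (ρ + 1) ≠ 0 := by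
    intro i hi
    rw [show t + 1 + i = (i + 1) + j * (ρ + 1) by omega, Nat.add_mul_mod_self_right,
      Nat.mod_eq_of_lt (by omega)]
    omega
  have hprob := isProbabilityMeasure_jointRoundLaw (τ := ρ + 1) (K := K) (t := t) h.b_le h.b'_le
  obtain ⟨hA, hA1, hA2⟩ := anchor_moments (b' := b') (K := K) (τ := ρ + 1) (t := t)
    h.one_le_clients h.one_le_b h.b_le h.b'_le h.wellPosed h.smooth h.boundedNoise h.V_nonneg y
    fun i => h.noise i y
  set A : (Fin M → RoundSample Z b b' K) → Vec d := fun ω =>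
    (M : ℝ)⁻¹ • ∑ i, batchGrad f i (ω i).2.1 y with hAdef
  set μ := jointRoundLaw D (ρ + 1) b b' K t with hμ
  have hsur : ∀ ω, surrogate (gap D f y) L η κ β y G (A ω) ρ y
      = gap D f y + ρ * η * (κ * (‖G‖ * ‖A ω‖) - inner ℝ G (A ω))
        + L / 2 * (ρ * (β * ‖A ω‖)) ^ 2 := by
    intro ω
    simp only [surrogate, sub_self, inner_zero_right, norm_zero]
    ring
  have iA := hA.integrable (q := 2) (by norm_num)
  have iG : Integrable (fun ω => inner ℝ G (A ω)) μ :=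
    integrable_inner_of_memLp (memLp_const G) hA
  have iS : Integrable (fun ω => ‖A ω‖ ^ 2) μ := integrable_sq_of_memLp hA
  have hint : Integrable (fun ω => surrogate (gap D f y) L η κ β y G (A ω) ρ y) μ := by
    simp_rw [hsur, mul_pow]
    exact ((integrable_const _).add (((iA.norm.const_mul _).const_mul _).sub iG |>.const_mul _)).add
      (((iS.const_mul _).const_mul _).const_mul _)
  have hmin := fun ω => h.expectAfter_miners_le (τ := ρ + 1) hκ0 hβ0 hκK (by rw [hβη, hη]) y (A ω)
    ρ (t + 1) hmiss y
  rw [← hη] at hmin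
  have h1 : expectAfter D f ηl ηs (ρ + 1) b b' K (fun s => ENNReal.ofReal (gap D f s.1)) t (ρ + 1)
      (y, g₀) ≤ ENNReal.ofReal (∫ ω, surrogate (gap D f y) L η κ β y G (A ω) ρ y ∂μ) := by
    rw [ofReal_integral_eq_lintegral_ofReal hint
      (Filter.Eventually.of_forall fun ω => (hmin ω).1)]
    have h0 : t % (ρ + 1) = 0 := Nat.mul_mod_left _ _
    simp only [expectAfter, seqRound, h0, if_true]
    exact lintegral_mono fun ω => (hmin ω).2
  have h2 : ∫ ω, surrogate (gap D f y) L η κ β y G (A ω) ρ y ∂μ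
      ≤ gap D f y + ρ * η * (θ * (V / M)) - ρ * η * (1 / 2 - θ) * ‖G‖ ^ 2 := by
    have hpt : ∀ ω, surrogate (gap D f y) L η κ β y G (A ω) ρ y
        ≤ gap D f y + ρ * η * (1 / 2 * ‖G‖ ^ 2) + ρ * η * θ * ‖A ω‖ ^ 2
          - ρ * η * inner ℝ G (A ω) := by
      intro ω
      -- Young's inequality spends half of the decrease `-‖G‖²` coming from `inner G (A ω)` on the
      -- bias. The other half of the product, `κ²/2`, and the quadratic term together form `θ`.
      have h3 : κ * (‖G‖ * ‖A ω‖) ≤ 1 / 2 * ‖G‖ ^ 2 + 1 / 2 * κ ^ 2 * ‖A ω‖ ^ 2 := by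
        nlinarith [sq_nonneg (‖G‖ - κ * ‖A ω‖)]
      have h4 := mul_le_mul_of_nonneg_left h3 (by positivity : 0 ≤ ρ * η)
      have h5 : L / 2 * (ρ * (β * ‖A ω‖)) ^ 2 = ρ * η * (9 / 4 * (L * (ρ * η))) * ‖A ω‖ ^ 2 := by
        rw [mul_pow, mul_pow β, hβη]
        ring
      rw [hsur, h5, hθ]
      rw [hκK] at h4
      linarith
    have i1 : Integrable (fun ω => ρ * η * θ * ‖A ω‖ ^ 2) μ := iS.const_mul _
    have i2 : Integrable (fun ω => ρ * η * inner ℝ G (A ω)) μ := iG.const_mul _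
    have hI : Integrable (fun ω => gap D f y + ρ * η * (1 / 2 * ‖G‖ ^ 2)
        + ρ * η * θ * ‖A ω‖ ^ 2 - ρ * η * inner ℝ G (A ω)) μ :=
      ((integrable_const _).add i1).sub i2
    refine (integral_mono hint hI hpt).trans ?_
    rw [integral_sub (f := fun ω => gap D f y + ρ * η * (1 / 2 * ‖G‖ ^ 2)
        + ρ * η * θ * ‖A ω‖ ^ 2) ((integrable_const _).add i1) i2,
      integral_add (integrable_const _) i1, integral_const_mul, integral_const_mul,
      integral_inner iA, hA1, ← hG, real_inner_self_eq_norm_sq]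
    have h6 := mul_le_mul_of_nonneg_left hA2 (by positivity : 0 ≤ ρ * η * θ)
    simp only [integral_const, probReal_univ, one_smul]
    linarith
  have h7 : 0 ≤ ρ * η * (1 / 2 - θ) * ‖G‖ ^ 2 :=
    mul_nonneg (mul_nonneg (by positivity) (by linarith)) (by positivity)
  refine (add_le_add_left h1 _).trans ?_
  rw [← ENNReal.ofReal_add (integral_nonneg fun ω => (hmin ω).1) h7,
    ← ENNReal.ofReal_add (h.wellPosed.gap_nonneg y) (by positivity)]
  exact ENNReal.ofReal_le_ofReal (by linarith)

end CycleAssumptions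

end Cycle

/-! ### Summation over cycles -/

section Convergence

variable {M d : ℕ} {Z : Type*} [MeasurableSpace Z] {D : Data M Z} {f : Fin M → Z → Vec d → ℝ}
  {b b' K τ : ℕ} {L Lσ σ V ηl ηs : ℝ} {Ω : Type*} [MeasurableSpace Ω] {P : Measure Ω}
  [IsProbabilityMeasure P] {ξ : ℕ → Fin M → Ω → RoundSample Z b b' K}

/-- Summing the decrease of the optimality gap over `n` cycles. -/
lemma CycleAssumptions.sum_gradient_le (h : CycleAssumptions D f b b' K L Lσ σ V ηl ηs) {ρ : ℕ}
    {η θ : ℝ} (hξ : IsRandomness P D (seqProb (ρ + 1)) ξ) (hη : η = ηs * (K * ηl))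
    (hθ : θ = 9 / 4 * ((L * ηl * K) ^ 2 + L * (ρ * η))) (hθ2 : θ ≤ 1 / 2)
    (s₀ : Vec d × Vec d) (n : ℕ) :
    ∫⁻ ω, ENNReal.ofReal (gap D f
        (seqRun f ηl ηs (ρ + 1) s₀ (fun r i => ξ r i ω) (n * (ρ + 1))).1) ∂P
      + ∑ j ∈ Finset.range n, ENNReal.ofReal (ρ * η * (1 / 2 - θ)) *
        ∫⁻ ω, ‖gradient (globalLoss D f)
          (seqRun f ηl ηs (ρ + 1) s₀ (fun r i => ξ r i ω) (j * (ρ + 1))).1‖ₑ ^ 2 ∂P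
      ≤ ENNReal.ofReal (gap D f s₀.1) + n * ENNReal.ofReal (ρ * η * (θ * (V / M))) := by
  have hη0 : 0 ≤ η := by
    rw [hη]
    have := h.ηs_nonneg
    have := h.ηl_nonneg
    positivity
  have hc0 : 0 ≤ ρ * η * (1 / 2 - θ) := mul_nonneg (by positivity) (by linarith)
  have hgap : Measurable fun s : Vec d × Vec d => ENNReal.ofReal (gap D f s.1) :=
    ENNReal.measurable_ofReal.comp
      ((h.smooth.differentiable_globalLoss.continuous.measurable.comp measurable_fst).sub_const _)
  have hgrad : Measurable fun s : Vec d × Vec d => ‖gradient (globalLoss D f) s.1‖ₑ ^ 2 :=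
    ((continuous_of_norm_sub_le (h.smooth.norm_gradient_globalLoss_sub_le
      h.one_le_clients)).measurable.comp measurable_fst).enorm.pow_const 2
  induction n with
  | zero => simp [seqRun]
  | succ n ih =>
    rw [Finset.sum_range_succ, show (n + 1) * (ρ + 1) = n * (ρ + 1) + (ρ + 1) by ring,
      hξ.lintegral_seqRun_add h.wellPosed h.b_le h.b'_le hgap (n * (ρ + 1)) (ρ + 1)]
    set X : Ω → Vec d × Vec d := fun ω =>
      seqRun f ηl ηs (ρ + 1) s₀ (fun r i => ξ r i ω) (n * (ρ + 1)) with hX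
    have hXm : AEMeasurable X P := hξ.aemeasurable_seqRun h.wellPosed _
    have hcycle : ∫⁻ ω, expectAfter D f ηl ηs (ρ + 1) b b' K
          (fun s => ENNReal.ofReal (gap D f s.1)) (n * (ρ + 1)) (ρ + 1) (X ω) ∂P
        + ENNReal.ofReal (ρ * η * (1 / 2 - θ)) *
          ∫⁻ ω, ‖gradient (globalLoss D f) (X ω).1‖ₑ ^ 2 ∂P
        ≤ ∫⁻ ω, ENNReal.ofReal (gap D f (X ω).1) ∂P
          + ENNReal.ofReal (ρ * η * (θ * (V / M))) := by
      have hg : AEMeasurable (fun ω => ‖gradient (globalLoss D f) (X ω).1‖ₑ ^ 2) P :=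
        hgrad.comp_aemeasurable hXm
      rw [← lintegral_const_mul'' _ hg, ← lintegral_add_right' _ (hg.const_mul _)]
      calc _ ≤ ∫⁻ ω, (ENNReal.ofReal (gap D f (X ω).1)
              + ENNReal.ofReal (ρ * η * (θ * (V / M)))) ∂P := by
            refine lintegral_mono fun ω => ?_
            have := h.expectAfter_cycle_le hη hθ hθ2 n (X ω)
            rwa [ENNReal.ofReal_mul hc0, ENNReal.ofReal_pow (norm_nonneg _), ofReal_norm] at this
        _ = _ := by
            rw [lintegral_add_right _ measurable_const]
            simp
    push_cast
    calc _ = (∫⁻ ω, expectAfter D f ηl ηs (ρ + 1) b b' K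
              (fun s => ENNReal.ofReal (gap D f s.1)) (n * (ρ + 1)) (ρ + 1) (X ω) ∂P
            + ENNReal.ofReal (ρ * η * (1 / 2 - θ)) *
              ∫⁻ ω, ‖gradient (globalLoss D f) (X ω).1‖ₑ ^ 2 ∂P)
          + ∑ j ∈ Finset.range n, ENNReal.ofReal (ρ * η * (1 / 2 - θ)) *
            ∫⁻ ω, ‖gradient (globalLoss D f)
              (seqRun f ηl ηs (ρ + 1) s₀ (fun r i => ξ r i ω) (j * (ρ + 1))).1‖ₑ ^ 2 ∂P := by ring
      _ ≤ (∫⁻ ω, ENNReal.ofReal (gap D f (X ω).1) ∂P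
            + ENNReal.ofReal (ρ * η * (θ * (V / M))))
          + ∑ j ∈ Finset.range n, ENNReal.ofReal (ρ * η * (1 / 2 - θ)) *
            ∫⁻ ω, ‖gradient (globalLoss D f)
              (seqRun f ηl ηs (ρ + 1) s₀ (fun r i => ξ r i ω) (j * (ρ + 1))).1‖ₑ ^ 2 ∂P := by
            gcongr
      _ = (∫⁻ ω, ENNReal.ofReal (gap D f (X ω).1) ∂P
          + ∑ j ∈ Finset.range n, ENNReal.ofReal (ρ * η * (1 / 2 - θ)) *
            ∫⁻ ω, ‖gradient (globalLoss D f)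
              (seqRun f ηl ηs (ρ + 1) s₀ (fun r i => ξ r i ω) (j * (ρ + 1))).1‖ₑ ^ 2 ∂P)
            + ENNReal.ofReal (ρ * η * (θ * (V / M))) := by ring
      _ ≤ _ := by
            refine (add_le_add_left ih _).trans (le_of_eq ?_)
            ring

/-- The convergence rate, up to the choice of the step sizes. -/
lemma CycleAssumptions.reachesWithin (h : CycleAssumptions D f b b' K L Lσ σ V ηl ηs)
    (hτ : 2 ≤ τ) (hξ : IsRandomness P D (seqProb τ) ξ) {η : ℝ} (hη : η = ηs * (K * ηl))
    (hη0 : 0 < η) (hητ : L * (τ * η) ≤ 7 / 100) (x₀ : Vec d) (v₀ : Fin M → Vec d) {Δ ε : ℝ}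
    (hΔ : gap D f x₀ ≤ Δ) (hε : 0 < ε) {T : ℕ} (hT : 0 < T)
    (hrate : 2 * Δ / (η * T) + 9 / 4 * ((L * ηl * K) ^ 2 + L * (τ * η)) * (V / M) ≤ 3 / 10 * ε) :
    ReachesWithin P D f x₀ v₀ ξ ηl ηs T ε := by
  obtain ⟨ρ, rfl⟩ : ∃ ρ, τ = ρ + 1 := ⟨τ - 1, by omega⟩
  have hΔ0 : 0 ≤ Δ := (h.wellPosed.gap_nonneg x₀).trans hΔ
  have hVM : 0 ≤ V / M := div_nonneg h.V_nonneg (Nat.cast_nonneg M)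
  have hL := h.L_nonneg
  have hρ1 : (1 : ℝ) ≤ ρ := by exact_mod_cast (by omega : 1 ≤ ρ)
  set θ := 9 / 4 * ((L * ηl * K) ^ 2 + L * (ρ * η)) with hθ
  have hLρ : L * (ρ * η) ≤ L * (((ρ + 1 : ℕ) : ℝ) * η) := by
    push_cast
    gcongr
    linarith
  have hθle : θ ≤ 9 / 4 * ((L * ηl * K) ^ 2 + L * (((ρ + 1 : ℕ) : ℝ) * η)) := by
    rw [hθ]
    gcongr
  -- `9/4 · (1/72 + 7/100) = 0.18875`.
  have hθ2 : θ < 1 / 5 := by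
    have := h.smallLocal
    linarith
  have hθ0 : 0 ≤ θ := by positivity
  -- `N = ⌈T/τ⌉` counts the anchor rounds before `T`. The last cycle may extend beyond round `T`;
  -- this is harmless, as only gradients at anchor rounds are summed.
  obtain ⟨N, hN1, hN2⟩ : ∃ N : ℕ, T ≤ N * (ρ + 1) ∧ ∀ j < N, j * (ρ + 1) < T := by
    refine ⟨(T + ρ) / (ρ + 1), ?_, fun j hj => ?_⟩
    · have h1 := Nat.div_add_mod (T + ρ) (ρ + 1)
      have h2 := Nat.mod_lt (T + ρ) (Nat.succ_pos ρ)
      rw [mul_comm] at h1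
      simp only [Nat.succ_eq_add_one] at h2
      omega
    · have h1 : (j + 1) * (ρ + 1) ≤ T + ρ :=
        (Nat.mul_le_mul_right _ hj).trans (Nat.div_mul_le_self _ _)
      have h2 : (j + 1) * (ρ + 1) = j * (ρ + 1) + ρ + 1 := by ring
      omega
  set s₀ : Vec d × Vec d := (x₀, (M : ℝ)⁻¹ • ∑ i, v₀ i) with hs₀
  have hrun : ∀ t, ∫⁻ ω, ‖gradient (globalLoss D f) (run f ηl ηs (fun _ => Finset.univ) x₀ v₀
        (fun r i => ξ r i ω) t).model‖ₑ ^ 2 ∂P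
      = ∫⁻ ω, ‖gradient (globalLoss D f)
        (seqRun f ηl ηs (ρ + 1) s₀ (fun r i => ξ r i ω) t).1‖ₑ ^ 2 ∂P := by
    intro t
    refine lintegral_congr_ae ?_
    filter_upwards [hξ.ae_coin h.b_le h.b'_le] with ω hω
    rw [hs₀, run_eq_seqRun h.one_le_clients x₀ v₀ _ hω t]
  by_contra hcon
  have hlow : ∀ j < N, ENNReal.ofReal ε ≤ ∫⁻ ω, ‖gradient (globalLoss D f)
      (seqRun f ηl ηs (ρ + 1) s₀ (fun r i => ξ r i ω) (j * (ρ + 1))).1‖ₑ ^ 2 ∂P := by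
    intro j hj
    by_contra hlt
    refine hcon ⟨j * (ρ + 1), hN2 j hj, ?_⟩
    rw [hrun]
    exact (not_le.1 hlt).le
  have hc0 : 0 ≤ ρ * η * (1 / 2 - θ) := mul_nonneg (by positivity) (by linarith)
  have hsum := h.sum_gradient_le hξ hη hθ (by linarith) s₀ N
  have hENN : ENNReal.ofReal (N * (ρ * η * (1 / 2 - θ) * ε))
      ≤ ENNReal.ofReal (Δ + N * (ρ * η * (θ * (V / M)))) := by
    rw [ENNReal.ofReal_add hΔ0 (by positivity), ENNReal.ofReal_mul (Nat.cast_nonneg N),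
      ENNReal.ofReal_mul (Nat.cast_nonneg N), ENNReal.ofReal_natCast, ENNReal.ofReal_mul hc0]
    calc (N : ENNReal) * (ENNReal.ofReal (ρ * η * (1 / 2 - θ)) * ENNReal.ofReal ε)
        = ∑ _j ∈ Finset.range N, ENNReal.ofReal (ρ * η * (1 / 2 - θ)) * ENNReal.ofReal ε := by
          simp
      _ ≤ ∑ j ∈ Finset.range N, ENNReal.ofReal (ρ * η * (1 / 2 - θ)) *
          ∫⁻ ω, ‖gradient (globalLoss D f)
            (seqRun f ηl ηs (ρ + 1) s₀ (fun r i => ξ r i ω) (j * (ρ + 1))).1‖ₑ ^ 2 ∂P :=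
          Finset.sum_le_sum fun j hj => mul_le_mul_right (hlow j (Finset.mem_range.1 hj)) _
      _ ≤ _ := le_add_self
      _ ≤ _ := hsum
      _ ≤ _ := by
          gcongr
  rw [ENNReal.ofReal_le_ofReal_iff (by positivity)] at hENN
  have hT0 : (0 : ℝ) < T := by exact_mod_cast hT
  have hNT : (T : ℝ) ≤ N * (ρ + 1) := by exact_mod_cast hN1
  have hN0 : (0 : ℝ) ≤ N := Nat.cast_nonneg N
  -- The factor 2 in the rate is the cost of the anchor rounds: `ρ + 1 ≤ 2ρ`.
  have hq : η * T ≤ 2 * (N * (ρ * η)) := by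
    have h1 : (T : ℝ) ≤ N * (2 * ρ) :=
      hNT.trans (mul_le_mul_of_nonneg_left (by linarith) hN0)
    calc η * T ≤ η * (N * (2 * ρ)) := by gcongr
      _ = _ := by ring
  have hq0 : 0 < N * (ρ * η) := by
    have : 0 < η * T := by positivity
    linarith
  have hmid : Δ ≤ N * (ρ * η) * (2 * Δ / (η * T)) := by
    have h1 : Δ = η * T * (Δ / (η * T)) := by field_simp
    have h2 : η * T * (Δ / (η * T)) ≤ 2 * (N * (ρ * η)) * (Δ / (η * T)) := by gcongr
    calc Δ ≤ 2 * (N * (ρ * η)) * (Δ / (η * T)) := by linarith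
      _ = _ := by ring
  have hupper : N * (ρ * η) * ((1 / 2 - θ) * ε) ≤ N * (ρ * η) * (3 / 10 * ε) := by
    have h1 : θ * (V / M)
        ≤ 9 / 4 * ((L * ηl * K) ^ 2 + L * (((ρ + 1 : ℕ) : ℝ) * η)) * (V / M) := by gcongr
    have h2 := mul_le_mul_of_nonneg_left (h1.trans (le_sub_iff_add_le'.2 hrate)) hq0.le
    linarith
  -- Since `1/2 - θ > 3/10`, this is incompatible with `ε > 0`.
  have hlast := le_of_mul_le_mul_left hupper hq0
  have h3 : 3 / 10 * ε = (1 / 2 - 1 / 5) * ε := by ring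
  have h4 : (1 / 2 - 1 / 5) * ε < (1 / 2 - θ) * ε := by gcongr
  linarith

end Convergence

/-! ### From admissible step sizes to the assumptions on a cycle -/

section StepSizes

variable {M d : ℕ} {Z : Type*} [MeasurableSpace Z] {D : Data M Z} {f : Fin M → Z → Vec d → ℝ}
  {b b' K τ : ℕ} {L Lσ σ V ηl ηs : ℝ} {Ω : Type*} [MeasurableSpace Ω] {P : Measure Ω}
  [IsProbabilityMeasure P] {ξ : ℕ → Fin M → Ω → RoundSample Z b b' K}

lemma StepSizes.local_le (h : StepSizes L Lσ K τ b' ηl ηs) (hL : 0 < L) (hK : 1 ≤ K) :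
    L * ηl * K ≤ 1 / (6 * √2) := by
  have hK0 : (0 : ℝ) < K := by exact_mod_cast hK
  have h1 := h.2.1
  have h2 : 0 < √2 := by positivity
  rw [le_div_iff₀ (by positivity)] at h1 ⊢
  linarith

lemma StepSizes.global_le (h : StepSizes L Lσ K τ b' ηl ηs) (hL : 0 < L) (hK : 1 ≤ K)
    (hτ : 2 ≤ τ) : L * (τ * (ηs * (K * ηl))) ≤ 7 / 100 := by
  have hK0 : (0 : ℝ) < K := by exact_mod_cast hK
  have hτ0 : (0 : ℝ) < τ := by exact_mod_cast (by omega : 0 < τ)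
  have h1 := h.1
  -- `6 · 24/10 = 14.4` exceeds `100/7`, which gives the constant `7/100`.
  have h2 : (24 / 10 : ℝ) ≤ √6 := Real.le_sqrt_of_sq_le (by norm_num)
  rw [le_div_iff₀ (by positivity)] at h1
  have h3 : L * (τ * (ηs * (K * ηl))) * (6 * √6) ≤ 1 := by linarith
  by_contra! h4
  nlinarith

/-- The convergence rate for admissible step sizes. -/
lemma reachesWithin_of_stepSizes (hM : 1 ≤ M) (hK : 1 ≤ K) (hτ : 2 ≤ τ) (hb1 : 1 ≤ b)
    (hb'1 : 1 ≤ b') (hb : (b : ℕ∞) ≤ D.size) (hb' : (b' : ℕ∞) ≤ D.size) (hL : 0 < L)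
    (hLσ : 0 ≤ Lσ) (hwp : WellPosed D f) (hsm : LSmooth D f L) (hσ : BoundedNoise D f σ)
    (has : AverageSmooth D f Lσ) (hV : 0 ≤ V)
    (hnoise : ∀ i x, ∫⁻ B : Fin b → Z, ‖batchGrad f i B x - gradient (localLoss D f i) x‖ₑ ^ 2
      ∂(D.batchLaw i b) ≤ ENNReal.ofReal V)
    (hξ : IsRandomness P D (seqProb τ) ξ) (x₀ : Vec d) (v₀ : Fin M → Vec d) {Δ ε : ℝ}
    (hΔ : gap D f x₀ ≤ Δ) (hε : 0 < ε) (hηl : 0 < ηl) (hηs : 0 < ηs)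
    (hstep : StepSizes L Lσ K τ b' ηl ηs) {T : ℕ} (hT : 0 < T) {η : ℝ} (hη : ηs * (K * ηl) = η)
    (hrate : 2 * Δ / (η * T) + 9 / 4 * ((L * ηl * K) ^ 2 + L * (τ * η)) * (V / M) ≤ 3 / 10 * ε) :
    ReachesWithin P D f x₀ v₀ ξ ηl ηs T ε := by
  have hK0 : (0 : ℝ) < K := by exact_mod_cast hK
  have hb'0 : (0 : ℝ) < b' := by exact_mod_cast hb'1
  have hlocal : (L * ηl * K) ^ 2 ≤ 1 / 72 := by
    calc (L * ηl * K) ^ 2 ≤ (1 / (6 * √2)) ^ 2 :=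
          pow_le_pow_left₀ (by positivity) (hstep.local_le hL hK) 2
      _ = _ := by
          rw [div_pow, mul_pow, Real.sq_sqrt (by norm_num)]
          norm_num
  have hsmall : Lσ ^ 2 / b' * ηl ^ 2 * K ≤ 1 / 12 := by
    have h1 := pow_le_pow_left₀ (by positivity) hstep.2.2 2
    rw [Real.sq_sqrt (by positivity), mul_pow, mul_pow, mul_pow, Real.sq_sqrt (by norm_num),
      le_div_iff₀ hK0] at h1
    have h2 : Lσ ^ 2 / b' * ηl ^ 2 * K = ηl ^ 2 * (2 ^ 2 * 3 * Lσ ^ 2) * K / (12 * b') := by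
      field_simp
      ring
    rw [h2, div_le_iff₀ (by positivity)]
    linarith
  have h : CycleAssumptions D f b b' K L Lσ σ V ηl ηs :=
    ⟨hM, hb1, hb'1, hb, hb', hwp, hsm, hσ, has, hnoise, hL.le, hV, hηl.le, hηs.le, hlocal, hsmall⟩
  refine h.reachesWithin hτ hξ hη.symm ?_ ?_ x₀ v₀ hΔ hε hT hrate
  · rw [← hη]
    positivity
  · rw [← hη]
    exact hstep.global_le hL hK hτ

end StepSizes

/-! ### Numerical rates for the three parameter choices -/

lemma mul_mul_le_of_sq_le {u τ C C₀ ε : ℝ} (hε : 0 ≤ ε)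
    (hC : 12 * C₀ ^ 2 ≤ C) (h : u ^ 2 * (C * τ ^ 2) ≤ ε ^ 2) : C₀ * (τ * u) ≤ 3 / 10 * ε := by
  refine le_of_sq_le_sq ?_ (by positivity)
  have h1 : u ^ 2 * (12 * C₀ ^ 2 * τ ^ 2) ≤ u ^ 2 * (C * τ ^ 2) := by gcongr
  -- The factor 12 suffices because `1/12 ≤ (3/10)²`.
  nlinarith [sq_nonneg ε]

section Rates

variable {L Δ c C C₀ ε σ T p s w ηl : ℝ} {M K τ b : ℝ}

/-- Here `p = η_s = K η_l`, so that `η = p²`. By the choice of `p` both terms are multiples of at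
most `τu`, where `u = p² σ²/M` and `u² = σ²/(MT)`; the gain `1/b` is discarded. -/
lemma rate_of_any_batch (hL : 0 < L) (hΔ : 0 ≤ Δ) (hε : 0 < ε) (hσ : 0 < σ) (hM : 0 < M)
    (hτ : 1 ≤ τ) (hb : 1 ≤ b) (hT : 0 < T) (hC₀ : 2 * Δ + 9 / 4 * (L ^ 2 + L) ≤ C₀)
    (hC : 12 * C₀ ^ 2 ≤ C) (hp : 0 < p) (hp4 : (p ^ 2) ^ 2 = M / (σ ^ 2 * T))
    (hCT : C * τ ^ 2 * (σ ^ 2 / (M * ε ^ 2)) ≤ T) :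
    2 * Δ / (p ^ 2 * T) + 9 / 4 * ((L * p) ^ 2 + L * (τ * p ^ 2)) * (σ ^ 2 / b / M)
      ≤ 3 / 10 * ε := by
  have hτ0 : 0 < τ := by linarith
  rw [mul_pow]
  set r := p ^ 2 with hr
  have hr0 : 0 < r := by positivity
  have h1 : 2 * Δ / (r * T) = 2 * Δ * (r * σ ^ 2 / M) := by
    have h2 : r ^ 2 * (σ ^ 2 * T) = M := by
      rw [hp4]
      field_simp
    rw [div_eq_iff (by positivity), ← h2]
    field_simp
  have h2 : 9 / 4 * (L ^ 2 * r + L * (τ * r)) * (σ ^ 2 / b / M)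
      ≤ 9 / 4 * (L ^ 2 + L) * (τ * (r * σ ^ 2 / M)) := by
    have h3 : L ^ 2 * r + L * (τ * r) ≤ (L ^ 2 + L) * (τ * r) := by
      have : r ≤ τ * r := le_mul_of_one_le_left hr0.le hτ
      nlinarith [sq_nonneg L]
    have h4 : σ ^ 2 / b / M ≤ σ ^ 2 / M := by
      gcongr
      exact div_le_self (by positivity) hb
    calc 9 / 4 * (L ^ 2 * r + L * (τ * r)) * (σ ^ 2 / b / M)
        ≤ 9 / 4 * ((L ^ 2 + L) * (τ * r)) * (σ ^ 2 / M) := by gcongr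
      _ = _ := by ring
  set u := r * σ ^ 2 / M with hu
  have hu0 : 0 ≤ u := by positivity
  have hsq : u ^ 2 * (C * τ ^ 2) ≤ ε ^ 2 := by
    have h3 : u ^ 2 = σ ^ 2 / (M * T) := by
      rw [hu, div_pow, mul_pow, hp4]
      field_simp
    have h4 : C * τ ^ 2 * σ ^ 2 ≤ T * (M * ε ^ 2) := by
      rwa [← mul_div_assoc, div_le_iff₀ (by positivity)] at hCT
    rw [h3, div_mul_eq_mul_div, div_le_iff₀ (by positivity)]
    linarith
  have h5 := mul_mul_le_of_sq_le hε.le hC hsq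
  have h6 : 2 * Δ * u ≤ 2 * Δ * (τ * u) := by
    gcongr
    exact le_mul_of_one_le_left hu0 hτ
  have h7 := mul_le_mul_of_nonneg_right hC₀ (mul_nonneg hτ0.le hu0)
  rw [h1]
  linarith

/-- Here `s = K η_l` and `w = η_s`. The balance is the same with `u = w s σ²/(KM)` and `u² =
σ²/(MKT)`: `K ≤ c b` trades `1/b` for `c/K`, and `L s ≤ 1` absorbs the quadratic term `(L s)²` into
the linear one. -/
lemma rate_of_batch_order_steps (hL : 0 < L) (hΔ : 0 ≤ Δ) (hε : 0 < ε) (hσ : 0 < σ)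
    (hM : 0 < M) (hK : 0 < K) (hτ : 1 ≤ τ) (hb : 0 < b) (hKb : K ≤ c * b) (hT : 0 < T)
    (hC₀ : 2 * Δ + 9 / 2 * (L * c) ≤ C₀) (hC : 12 * C₀ ^ 2 ≤ C)
    (hs : 0 < s) (hs2 : s ^ 2 * (T * σ ^ 2) = 1) (hw : 1 ≤ w) (hw2 : w ^ 2 = K * M)
    (hLs : L * s ≤ 1) (hCT : C * τ ^ 2 * (σ ^ 2 / (M * K * ε ^ 2)) ≤ T) :
    2 * Δ / (w * s * T) + 9 / 4 * ((L * s) ^ 2 + L * (τ * (w * s))) * (σ ^ 2 / b / M)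
      ≤ 3 / 10 * ε := by
  have hτ0 : 0 < τ := by linarith
  have hw0 : 0 < w := by linarith
  set u := w * s * σ ^ 2 / (K * M) with hu
  have hu0 : 0 ≤ u := by positivity
  have h1 : 2 * Δ / (w * s * T) = 2 * Δ * u := by
    rw [div_eq_iff (by positivity), hu, ← hw2]
    have h2 : w * s * σ ^ 2 / w ^ 2 * (w * s * T) = s ^ 2 * (T * σ ^ 2) := by field_simp
    rw [mul_assoc, h2, hs2, mul_one]
  have h2 : 9 / 4 * ((L * s) ^ 2 + L * (τ * (w * s))) * (σ ^ 2 / b / M)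
      ≤ 9 / 2 * (L * c) * (τ * u) := by
    have h3 : (L * s) ^ 2 + L * (τ * (w * s)) ≤ 2 * (L * (τ * (w * s))) := by
      have h4 : (L * s) ^ 2 ≤ L * s := by nlinarith [mul_pos hL hs]
      have h5 : L * s ≤ L * (τ * (w * s)) := by
        gcongr
        exact (le_mul_of_one_le_left hs.le hw).trans (le_mul_of_one_le_left (by positivity) hτ)
      linarith
    have h4 : σ ^ 2 / b / M ≤ c * (σ ^ 2 / (K * M)) := by
      rw [div_div, mul_div_assoc', div_le_div_iff₀ (by positivity) (by positivity)]
      have := mul_le_mul_of_nonneg_left hKb (by positivity : 0 ≤ σ ^ 2 * M)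
      linarith
    calc 9 / 4 * ((L * s) ^ 2 + L * (τ * (w * s))) * (σ ^ 2 / b / M)
        ≤ 9 / 4 * (2 * (L * (τ * (w * s)))) * (c * (σ ^ 2 / (K * M))) := by gcongr
      _ = _ := by
          rw [hu]
          ring
  have hsq : u ^ 2 * (C * τ ^ 2) ≤ ε ^ 2 := by
    have h3 : u ^ 2 * (M * K * T) = σ ^ 2 := by
      have h4 : u ^ 2 * (M * K * T) = w ^ 2 * (s ^ 2 * (T * σ ^ 2)) * σ ^ 2 / (K * M) := by
        rw [hu]
        field_simp
      rw [h4, hw2, hs2]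
      field_simp
    have h4 : C * τ ^ 2 * σ ^ 2 ≤ T * (M * K * ε ^ 2) := by
      rwa [← mul_div_assoc, div_le_iff₀ (by positivity)] at hCT
    have h5 : u ^ 2 * (C * τ ^ 2) * (M * K * T) ≤ ε ^ 2 * (M * K * T) := by
      calc u ^ 2 * (C * τ ^ 2) * (M * K * T) = C * τ ^ 2 * (u ^ 2 * (M * K * T)) := by ring
        _ ≤ _ := by
            rw [h3]
            linarith
    exact le_of_mul_le_mul_right h5 (by positivity)
  have h5 := mul_mul_le_of_sq_le hε.le hC hsq
  have h6 : 2 * Δ * u ≤ 2 * Δ * (τ * u) := by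
    gcongr
    exact le_mul_of_one_le_left hu0 hτ
  have h7 := mul_le_mul_of_nonneg_right hC₀ (mul_nonneg hτ0.le hu0)
  rw [h1]
  linarith

/-- The step sizes do not shrink with `T`. The noise term takes `9/4 · (1/72 + 7/100) < 19/100` of
`ε`; the other one is `12√6 LΔτ/T ≤ 30 LΔτ/T`, and requiring at most `ε/10` explains the 300. -/
lemma rate_of_large_batch {V : ℝ} (hL : 0 < L) (hΔ : 0 ≤ Δ) (hε : 0 < ε) (hM : 0 < M)
    (hτ : 0 < τ) (hT : 0 < T) (hC : 300 * L * Δ ≤ C) (hV : 0 ≤ V) (hVM : V / M ≤ ε)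
    (hlocal : (L * ηl * K) ^ 2 ≤ 1 / 72) (hglobal : L * (τ * (1 / (6 * √6 * L * τ))) ≤ 7 / 100)
    (hCT : C * (τ / ε) ≤ T) :
    2 * Δ / (1 / (6 * √6 * L * τ) * T)
      + 9 / 4 * ((L * ηl * K) ^ 2 + L * (τ * (1 / (6 * √6 * L * τ)))) * (V / M) ≤ 3 / 10 * ε := by
  have h1 : 9 / 4 * ((L * ηl * K) ^ 2 + L * (τ * (1 / (6 * √6 * L * τ)))) * (V / M)
      ≤ 19 / 100 * ε := by
    have hV0 : 0 ≤ V / M := by positivity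
    calc _ ≤ 9 / 4 * (1 / 72 + 7 / 100) * ε := by gcongr
      _ ≤ _ := by linarith
  have h2 : 2 * Δ / (1 / (6 * √6 * L * τ) * T) ≤ 1 / 10 * ε := by
    have h6 : √(6 : ℝ) ≤ 5 / 2 := Real.sqrt_le_iff.2 (by norm_num)
    have h3 : 300 * L * Δ * τ ≤ T * ε := by
      rw [← mul_div_assoc, div_le_iff₀ hε] at hCT
      exact (mul_le_mul_of_nonneg_right hC hτ.le).trans hCT
    have h4 : 2 * Δ / (1 / (6 * √6 * L * τ) * T) = 12 * √6 * (L * Δ * τ) / T := by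
      field_simp
      ring
    rw [h4, div_le_iff₀ hT]
    have h5 : 12 * √6 * (L * Δ * τ) ≤ 12 * (5 / 2) * (L * Δ * τ) := by gcongr
    linarith
  linarith

end Rates

end FedAMD

/-! ### The three complexity bounds -/

open FedAMD in
theorem corollary1 (L Δ c : ℝ) (hL : 0 < L) (hc : 0 < c) :
    ∃ C : ℝ, 0 < C ∧
      ∀ (M d K τ b b' : ℕ), 1 ≤ M → 1 ≤ K → 2 ≤ τ → 1 ≤ b → 1 ≤ b' →
      ∀ (σ Lσ : ℝ), 0 < σ → 0 ≤ Lσ →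
      ∀ (Z : Type*) [MeasurableSpace Z] (Ω : Type*) [MeasurableSpace Ω]
        (P : Measure Ω) [IsProbabilityMeasure P]
        (D : FedAMD.Data M Z) (f : Fin M → Z → FedAMD.Vec d → ℝ)
        (x₀ : FedAMD.Vec d) (v₀ : Fin M → FedAMD.Vec d)
        (ξ : ℕ → Fin M → Ω → FedAMD.RoundSample Z b b' K),
      (b : ℕ∞) ≤ D.size → (b' : ℕ∞) ≤ D.size →
      FedAMD.WellPosed D f →
      FedAMD.LSmooth D f L → FedAMD.BoundedNoise D f σ → FedAMD.AverageSmooth D f Lσ →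
      FedAMD.globalLoss D f x₀ - (⨅ x, FedAMD.globalLoss D f x) ≤ Δ →
      FedAMD.IsRandomness P D (FedAMD.seqProb τ) ξ →
      ∀ ε : ℝ, 0 < ε →
        -- `b = O(1)`
        (∀ (T : ℕ) (ηl ηs : ℝ),
          ηl = 1 / K * ((M : ℝ) / (σ ^ 2 * T)) ^ (1 / 4 : ℝ) →
          ηs = ((M : ℝ) / (σ ^ 2 * T)) ^ (1 / 4 : ℝ) →
          FedAMD.StepSizes L Lσ K τ b' ηl ηs →
          C * τ ^ 2 * (σ ^ 2 / (M * ε ^ 2)) ≤ T →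
          FedAMD.ReachesWithin P D f x₀ v₀ ξ ηl ηs T ε) ∧
        -- `b` of the order of `K`
        ((K : ℝ) ≤ c * b → ∀ (T : ℕ) (ηl ηs : ℝ),
          ηl = 1 / (√(T : ℝ) * K * σ) →
          ηs = √((K : ℝ) * M) →
          FedAMD.StepSizes L Lσ K τ b' ηl ηs →
          C * τ ^ 2 * (σ ^ 2 / (M * K * ε ^ 2)) ≤ T →
          FedAMD.ReachesWithin P D f x₀ v₀ ξ ηl ηs T ε) ∧
        -- `b = min {n, σ² / (M ε)}`, rounded up to an integer
        ((b : ℕ∞) = min D.size (⌈σ ^ 2 / (M * ε)⌉₊ : ℕ∞) →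
          (K : ℝ) = Lσ ^ 2 / (6 * b' * L ^ 2) → ∀ (T : ℕ) (ηl ηs : ℝ),
          ηl = 1 / (6 * √2 * K * L) →
          ηs = 1 / (√3 * τ) →
          C * (τ / ε) ≤ T →
          FedAMD.ReachesWithin P D f x₀ v₀ ξ ηl ηs T ε) := by
  -- `C₀` dominates the constants of the first two cases. It uses `|Δ|` because `Δ ≥ 0` is known
  -- only once a problem is given. Positivity of `C` lets each lower bound on `T` force `T > 0`.
  set C₀ : ℝ := 2 * |Δ| + 9 / 4 * (L ^ 2 + L) + 9 / 2 * (L * c) with hC₀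
  refine ⟨12 * C₀ ^ 2 + 300 * L * |Δ| + 1, by positivity, ?_⟩
  set C : ℝ := 12 * C₀ ^ 2 + 300 * L * |Δ| + 1 with hC
  have hC12 : 12 * C₀ ^ 2 ≤ C := by
    have : 0 ≤ 300 * L * |Δ| := by positivity
    linarith
  have hC300 : 300 * L * |Δ| ≤ C := by nlinarith [sq_nonneg C₀]
  have hC0 : 0 < C := by positivity
  intro M d K τ b b' hM hK hτ hb1 hb'1 σ Lσ hσ hLσ Z _ Ω _ P _ D f x₀ v₀ ξ hb hb' hwp hsm hbn has
    hΔ hξ ε hε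
  have hΔ0 : |Δ| = Δ := abs_of_nonneg ((hwp.gap_nonneg x₀).trans hΔ)
  rw [hΔ0] at hC₀ hC300
  have hΔ0' : 0 ≤ Δ := hΔ0 ▸ abs_nonneg Δ
  have hM0 : (0 : ℝ) < M := by exact_mod_cast hM
  have hK0 : (0 : ℝ) < K := by exact_mod_cast hK
  have hK1 : (1 : ℝ) ≤ K := by exact_mod_cast hK
  have hM1 : (1 : ℝ) ≤ M := by exact_mod_cast hM
  have hτ1 : (1 : ℝ) ≤ τ := by exact_mod_cast (by omega : 1 ≤ τ)
  have hτ0 : (0 : ℝ) < τ := by linarith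
  have hb0 : (0 : ℝ) < b := by exact_mod_cast hb1
  have hb'0 : (0 : ℝ) < b' := by exact_mod_cast hb'1
  have hb1' : (1 : ℝ) ≤ b := by exact_mod_cast hb1
  have hC₀1 : 2 * Δ + 9 / 4 * (L ^ 2 + L) ≤ C₀ := by
    have : 0 ≤ 9 / 2 * (L * c) := by positivity
    linarith
  have hC₀2 : 2 * Δ + 9 / 2 * (L * c) ≤ C₀ := by
    have : 0 ≤ 9 / 4 * (L ^ 2 + L) := by positivity
    linarith
  refine ⟨?_, ?_, ?_⟩
  · intro T ηl ηs hηl hηs hstep hT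
    have hTpos : (0 : ℝ) < T := lt_of_lt_of_le (by positivity) hT
    set p := ((M : ℝ) / (σ ^ 2 * T)) ^ (1 / 4 : ℝ) with hp
    have hp0 : 0 < p := by positivity
    have hp4 : (p ^ 2) ^ 2 = M / (σ ^ 2 * T) := by
      rw [← pow_mul, hp, ← Real.rpow_natCast, ← Real.rpow_mul (by positivity)]
      norm_num
    have hη : ηs * (K * ηl) = p ^ 2 := by
      rw [hηl, hηs]
      field_simp
    refine reachesWithin_of_stepSizes hM hK hτ hb1 hb'1 hb hb' hL hLσ hwp hsm hbn has
      (by positivity : 0 ≤ σ ^ 2 / b) (fun i => hbn i b hb1 hb) hξ x₀ v₀ hΔ hε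
      (hηl ▸ by positivity) (hηs ▸ by positivity) hstep (by exact_mod_cast hTpos) hη ?_
    have hlocal : L * ηl * K = L * p := by
      rw [hηl]
      field_simp
    rw [hlocal]
    exact rate_of_any_batch hL hΔ0' hε hσ hM0 hτ1 hb1' hTpos hC₀1 hC12 hp0 hp4 hT
  · intro hKb T ηl ηs hηl hηs hstep hT
    have hTpos : (0 : ℝ) < T := lt_of_lt_of_le (by positivity) hT
    set s := 1 / (√(T : ℝ) * σ) with hs
    have hs0 : 0 < s := by positivity
    have hs2 : s ^ 2 * (T * σ ^ 2) = 1 := by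
      rw [hs, div_pow, mul_pow, Real.sq_sqrt hTpos.le]
      field_simp
    set w := √((K : ℝ) * M) with hw
    have hw2 : w ^ 2 = K * M := Real.sq_sqrt (by positivity)
    have hw1 : 1 ≤ w := Real.one_le_sqrt.2 (one_le_mul_of_one_le_of_one_le hK1 hM1)
    have hw0 : 0 < w := by linarith
    have hηlK : ηl * K = s := by
      rw [hηl, hs]
      field_simp
    have hη : ηs * (K * ηl) = w * s := by rw [mul_comm (K : ℝ), hηlK, hηs]
    have hηl0 : 0 < ηl := hηl ▸ by positivity
    refine reachesWithin_of_stepSizes hM hK hτ hb1 hb'1 hb hb' hL hLσ hwp hsm hbn has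
      (by positivity : 0 ≤ σ ^ 2 / b) (fun i => hbn i b hb1 hb) hξ x₀ v₀ hΔ hε
      hηl0 (hηs ▸ hw0) hstep (by exact_mod_cast hTpos) hη ?_
    have hLs : L * s ≤ 1 := by
      have h1 := hstep.local_le hL hK
      rw [mul_assoc, hηlK] at h1
      refine h1.trans ?_
      rw [div_le_one (by positivity)]
      have : 1 ≤ √(2 : ℝ) := Real.one_le_sqrt.2 (by norm_num)
      linarith
    rw [mul_assoc L, hηlK]
    exact rate_of_batch_order_steps hL hΔ0' hε hσ hM0 hK0 hτ1 hb0 hKb hTpos hC₀2 hC12 hs0 hs2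
      hw1 hw2 hLs hT
  · intro hbmin hKeq T ηl ηs hηl hηs hT
    have hTpos : (0 : ℝ) < T := lt_of_lt_of_le (by positivity) hT
    have h23 : √(2 : ℝ) * √3 = √6 := by
      rw [← Real.sqrt_mul (by norm_num)]
      norm_num
    have hηl0 : 0 < ηl := hηl ▸ by positivity
    have hηs0 : 0 < ηs := hηs ▸ by positivity
    have hη : ηs * (K * ηl) = 1 / (6 * √6 * L * τ) := by
      rw [hηl, hηs, ← h23]
      field_simp
    have hstep : StepSizes L Lσ K τ b' ηl ηs := by
      refine ⟨?_, hηl.le, ?_⟩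
      · rw [hηl, hηs, ← h23]
        apply le_of_eq
        field_simp
      -- The prescribed `K` is the value at which the noise constraint is an equality.
      · refine Real.le_sqrt_of_sq_le (le_of_eq ?_)
        have hLσ2 : Lσ ^ 2 = K * (6 * b' * L ^ 2) := by
          rw [hKeq]
          field_simp
        have h2 : √(2 : ℝ) ^ 2 = 2 := Real.sq_sqrt (by norm_num)
        have h3 : √(3 : ℝ) ^ 2 = 3 := Real.sq_sqrt (by norm_num)
        rw [hηl, mul_pow, mul_pow, mul_pow, div_pow, mul_pow, mul_pow, mul_pow, h2, h3, hLσ2]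
        field_simp
        norm_num
    obtain ⟨V, hV, hVM, hnoise⟩ : ∃ V : ℝ, 0 ≤ V ∧ V / M ≤ ε ∧ ∀ i x,
        ∫⁻ B : Fin b → Z, ‖batchGrad f i B x - gradient (localLoss D f i) x‖ₑ ^ 2
          ∂(D.batchLaw i b) ≤ ENNReal.ofReal V := by
      -- Either the batch is the whole dataset and has no noise, or `b ≥ σ²/(Mε)`, so that `V =
      -- σ²/b` satisfies `V/M ≤ ε`.
      rcases min_choice D.size (⌈σ ^ 2 / (M * ε)⌉₊ : ℕ∞) with h | h
      · refine ⟨0, le_rfl, by simpa using hε.le, fun i x => ?_⟩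
        rw [lintegral_noise_full_batch hwp i (hbmin.trans h) x]
        exact zero_le
      · refine ⟨σ ^ 2 / b, by positivity, ?_, fun i => hbn i b hb1 hb⟩
        have hbe : b = ⌈σ ^ 2 / (M * ε)⌉₊ := by exact_mod_cast hbmin.trans h
        have hle : σ ^ 2 / (M * ε) ≤ b := by
          rw [hbe]
          exact Nat.le_ceil _
        rw [div_le_iff₀ (by positivity)] at hle
        rw [div_div, div_le_iff₀ (by positivity)]
        linarith
    refine reachesWithin_of_stepSizes hM hK hτ hb1 hb'1 hb hb' hL hLσ hwp hsm hbn has hV hnoise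
      hξ x₀ v₀ hΔ hε hηl0 hηs0 hstep (by exact_mod_cast hTpos) hη ?_
    have hlocal : (L * ηl * K) ^ 2 ≤ 1 / 72 := by
      calc (L * ηl * K) ^ 2 ≤ (1 / (6 * √2)) ^ 2 :=
            pow_le_pow_left₀ (by positivity) (hstep.local_le hL hK) 2
        _ = _ := by
            rw [div_pow, mul_pow, Real.sq_sqrt (by norm_num)]
            norm_num
    have hglobal := hstep.global_le hL hK hτ
    rw [hη] at hglobal
    exact rate_of_large_batch hL hΔ0' hε hM0 hτ0 hTpos hC300 hV hVM hlocal hglobal hT
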